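/- Let $\mathbf{k}$ be a field of characteristic $0$. All ns (nonsymmetric) operads are over $\mathbf k$, and an isomorphism of ns operads is an arity-wise linear isomorphism compatible with the identity and the compositions. A finitely generated unary binary quadratic ns operad is given by finite-dimensional vector spaces $E_1$ (unary generators) and $E_2$ (binary generators) and relations $R=(R_1,R_2,R_3)$, which are subspaces of the weight two parts, in arities $1,2,3$, of the free ns operad $\mathscr T(E)$ on $E=\{0,E_1,E_2,0,\dots\}$: $$R_1\subseteq E_1\otimes E_1,\qquad R_2\subseteq (E_1\otimes E_2)\oplus(E_2\otimes E_1)\oplus(E_2\otimes E_1),\qquad R_3\subseteq (E_2\otimes E_2)\oplus(E_2\otimes E_2).$$ Here the summands are spanned respectively by $\alpha\circ_1\beta$; by $\alpha\circ_1\mu$, $\mu\circ_1\alpha$, $\mu\circ_2\alpha$; and by $\mu\circ_1\nu$, $\mu\circ_2\nu$, with $\alpha,\beta\in E_1$ and $\mu,\nu\in E_2$. The operad is $\mathscr P=\mathscr P(E,R)=\mathscr T(E)/\langle R\rangle$. **Koszul dual.** $\mathscr P^!:=\mathscr T(E^*)/\langle R^\perp\rangle$, where $R_i^\perp$ is the orthogonal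 of $R_i$ for the pairing between the weight two parts of $\mathscr T(E^*)$ and $\mathscr T(E)$ given by $$\langle\alpha^*\circ_1\beta^*,\alpha\circ_1\beta\rangle=\alpha^*(\alpha)\beta^*(\beta),\quad \langle\alpha^*\circ_1\mu^*,\alpha\circ_1\mu\rangle=-\alpha^*(\alpha)\mu^*(\mu),\quad \langle\mu^*\circ_j\alpha^*,\mu\circ_j\alpha\rangle=\mu^*(\mu)\alpha^*(\alpha)\ (j=1,2),$$ $$\langle\mu^*\circ_1\nu^*,\mu\circ_1\nu\rangle=\mu^*(\mu)\nu^*(\nu),\quad \langle\mu^*\circ_2\nu^*,\mu\circ_2\nu\rangle=-\mu^*(\mu)\nu^*(\nu),$$ and by $0$ between trees of different shapes. $\mathscr P$ is called self-dual if $\mathscr P\cong\mathscr P^!$ as ns operads. **Matching operad.** Let $\Omega$ be a nonempty set, and for $\omega\in\Omega$ let $E_\omega$ be a copy of $E$, with $x_\omega\in E_\omega$ the copy of $x\in E$. For $\mu,\nu\in\Omega$ let $R_i^{\mu,\nu}$ be the image of $R_i$ under the linear map that puts indices on the generators as follows. In arity $1$: $\alpha\circ_1\beta\mapsto\alpha_\nu\circ_1\beta_\mu$.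 In arity $2$: every unary generator gets the index $\mu$ and every binary generator the index $\nu$. In arity $3$: $a\circ_1 b\mapsto a_\nu\circ_1 b_\mu$ and $a\circ_2 b\mapsto a_\mu\circ_2 b_\nu$ (so that $(x\ast y)\star z$ becomes $(x\ast_\mu y)\star_\nu z$ and $x\ast(y\star z)$ becomes $x\ast_\mu(y\star_\nu z)$). Then $$\mathrm{mat}(\mathscr P)_\Omega:=\mathscr T\Big(\bigoplus_{\omega\in\Omega}E_\omega\Big)\Big/\Big\langle\bigcup_{\mu,\nu\in\Omega,\ i=1,2,3}R_i^{\mu,\nu}\Big\rangle .$$ **Theorem.** Let $\Omega$ be a nonempty finite set and let $\mathscr P=\mathscr T(E)/\langle R\rangle$ be a finitely generated unary binary quadratic ns operad. Then $$(\mathrm{mat}(\mathscr P)_\Omega)^!=\mathrm{mat}(\mathscr P^!)_\Omega ,$$ that is, the canonical identification $\big(\bigoplus_\omega E_\omega\big)^*\cong\bigoplus_\omega E_\omega^*$ of the generators (under which $\varphi\circ\mathrm{pr}_\omega$ corresponds to the copy $\varphi_\omega$ of $\varphi\in E^*$) induces an isomorphism of ns operads. In particular, if $\mathscr P$ is self-dual,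 then so is $\mathrm{mat}(\mathscr P)_\Omega$. -/

import Mathlib

open scoped TensorProduct

universe u v w v₁ v₂

/-! ## Nonsymmetric operads -/

/-- A nonsymmetric operad over `k`, given by its identity and its partial compositions.
For `x` of arity `m = a + 1 + b` and `y` of arity `n`, `comp a b _ _ x y` is `x ∘_{a+1} y`: the
output of `y` is plugged into the input of `x` that has `a` inputs to its left and `b` inputs to
its right. The arity equations are arguments, so that the axioms need no transport along them. -/
structure NSOperad (k : Type u) [Field k] where
  obj : ℕ → Type v
  addCommGroup : ∀ n, AddCommGroup (obj n)
  module : ∀ n, Module k (obj n)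
  one : obj 1
  comp : ∀ {m n r : ℕ} (a b : ℕ), m = a + 1 + b → r = a + n + b →
    (obj m →ₗ[k] obj n →ₗ[k] obj r)
  one_comp : ∀ {n : ℕ} (h : 1 = 0 + 1 + 0) (h' : n = 0 + n + 0) (x : obj n),
    comp 0 0 h h' one x = x
  comp_one : ∀ {m : ℕ} (a b : ℕ) (h : m = a + 1 + b) (h' : m = a + 1 + b) (x : obj m),
    comp a b h h' x one = x
  /-- Sequential composition: `(x ∘ y) ∘ z = x ∘ (y ∘ z)` when `z` is plugged into `y`. -/
  comp_seq : ∀ {l m n p q r : ℕ} (a b c d : ℕ) (h₁ : l = a + 1 + b) (h₂ : p = a + m + b)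
    (h₃ : p = (a + c) + 1 + (d + b)) (h₄ : r = (a + c) + n + (d + b))
    (h₅ : m = c + 1 + d) (h₆ : q = c + n + d) (h₇ : r = a + q + b)
    (x : obj l) (y : obj m) (z : obj n),
    comp (a + c) (d + b) h₃ h₄ (comp a b h₁ h₂ x y) z
      = comp a b h₁ h₇ x (comp c d h₅ h₆ y z)
  /-- Parallel composition: plugging `y` and `z` into two different inputs of `x` (that of `y`
  to the left of that of `z`) can be done in either order. -/
  comp_par : ∀ {l m n p q r : ℕ} (a b c : ℕ) (h₁ : l = a + 1 + (b + 1 + c))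
    (h₂ : p = a + m + (b + 1 + c)) (h₃ : p = (a + m + b) + 1 + c) (h₄ : r = (a + m + b) + n + c)
    (h₅ : l = (a + 1 + b) + 1 + c) (h₆ : q = (a + 1 + b) + n + c)
    (h₇ : q = a + 1 + (b + n + c)) (h₈ : r = a + m + (b + n + c))
    (x : obj l) (y : obj m) (z : obj n),
    comp (a + m + b) c h₃ h₄ (comp a (b + 1 + c) h₁ h₂ x y) z
      = comp a (b + n + c) h₇ h₈ (comp (a + 1 + b) c h₅ h₆ x z) y

attribute [instance] NSOperad.addCommGroup NSOperad.module

namespace NSOperad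

variable {k : Type u} [Field k]

/-- An isomorphism of ns operads: linear isomorphisms in every arity, compatible with the
identities and the compositions. -/
structure Iso (P : NSOperad.{u, v} k) (Q : NSOperad.{u, w} k) where
  equiv : ∀ n, P.obj n ≃ₗ[k] Q.obj n
  map_one : equiv 1 P.one = Q.one
  map_comp : ∀ {m n r : ℕ} (a b : ℕ) (h : m = a + 1 + b) (h' : r = a + n + b)
    (x : P.obj m) (y : P.obj n),
    equiv r (P.comp a b h h' x y) = Q.comp a b h h' (equiv m x) (equiv n y)

/-- Membership in the operadic ideal generated by a family `S` of sets of elements. -/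
inductive InIdeal (P : NSOperad.{u, v} k) (S : ∀ n, Set (P.obj n)) : ∀ n, P.obj n → Prop
  | of {n : ℕ} {x : P.obj n} : x ∈ S n → InIdeal P S n x
  | zero {n : ℕ} : InIdeal P S n 0
  | add {n : ℕ} {x y : P.obj n} : InIdeal P S n x → InIdeal P S n y → InIdeal P S n (x + y)
  | smul {n : ℕ} (c : k) {x : P.obj n} : InIdeal P S n x → InIdeal P S n (c • x)
  | comp_left {m n r : ℕ} (a b : ℕ) (h : m = a + 1 + b) (h' : r = a + n + b)
      {x : P.obj m} (y : P.obj n) : InIdeal P S m x → InIdeal P S r (P.comp a b h h' x y)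
  | comp_right {m n r : ℕ} (a b : ℕ) (h : m = a + 1 + b) (h' : r = a + n + b)
      (x : P.obj m) {y : P.obj n} : InIdeal P S n y → InIdeal P S r (P.comp a b h h' x y)

/-- The operadic ideal `⟨S⟩` generated by `S`, in each arity. -/
def ideal (P : NSOperad.{u, v} k) (S : ∀ n, Set (P.obj n)) (n : ℕ) : Submodule k (P.obj n) where
  carrier := {x | InIdeal P S n x}
  add_mem' := InIdeal.add
  zero_mem' := InIdeal.zero
  smul_mem' c _ hx := InIdeal.smul c hx

/-- The partial compositions induced on the quotient `P / ⟨S⟩`. -/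
def quotComp (P : NSOperad.{u, v} k) (S : ∀ n, Set (P.obj n)) {m n r : ℕ} (a b : ℕ)
    (h : m = a + 1 + b) (h' : r = a + n + b) :
    (P.obj m ⧸ P.ideal S m) →ₗ[k] (P.obj n ⧸ P.ideal S n) →ₗ[k] (P.obj r ⧸ P.ideal S r) :=
  (P.ideal S m).liftQ
    { toFun := fun x => (P.ideal S n).mapQ (P.ideal S r) (P.comp a b h h' x)
        (fun _ hy => InIdeal.comp_right a b h h' x hy)
      map_add' := fun x y => by
        refine LinearMap.ext fun z => ?_
        obtain ⟨z, rfl⟩ := Submodule.mkQ_surjective _ z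
        change (P.ideal S r).mkQ (P.comp a b h h' (x + y) z)
          = (P.ideal S r).mkQ (P.comp a b h h' x z) + (P.ideal S r).mkQ (P.comp a b h h' y z)
        rw [map_add, LinearMap.add_apply, map_add]
      map_smul' := fun c x => by
        refine LinearMap.ext fun z => ?_
        obtain ⟨z, rfl⟩ := Submodule.mkQ_surjective _ z
        change (P.ideal S r).mkQ (P.comp a b h h' (c • x) z)
          = c • (P.ideal S r).mkQ (P.comp a b h h' x z)
        rw [map_smul, LinearMap.smul_apply, map_smul] }
    (fun x hx => by
      rw [LinearMap.mem_ker]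
      ext y
      exact (Submodule.Quotient.mk_eq_zero _).2 (InIdeal.comp_left a b h h' y hx))

theorem quotComp_mk (P : NSOperad.{u, v} k) (S : ∀ n, Set (P.obj n)) {m n r : ℕ} (a b : ℕ)
    (h : m = a + 1 + b) (h' : r = a + n + b) (x : P.obj m) (y : P.obj n) :
    P.quotComp S a b h h' ((P.ideal S m).mkQ x) ((P.ideal S n).mkQ y)
      = (P.ideal S r).mkQ (P.comp a b h h' x y) := rfl

/-- The quotient operad `P / ⟨S⟩`. -/
abbrev quot (P : NSOperad.{u, v} k) (S : ∀ n, Set (P.obj n)) : NSOperad.{u, v} k where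
  obj n := P.obj n ⧸ P.ideal S n
  addCommGroup _ := inferInstance
  module _ := inferInstance
  one := (P.ideal S 1).mkQ P.one
  comp a b h h' := P.quotComp S a b h h'
  one_comp h h' x := by
    obtain ⟨x, rfl⟩ := Submodule.mkQ_surjective _ x
    rw [quotComp_mk, P.one_comp]
  comp_one a b h h' x := by
    obtain ⟨x, rfl⟩ := Submodule.mkQ_surjective _ x
    rw [quotComp_mk, P.comp_one]
  comp_seq a b c d h₁ h₂ h₃ h₄ h₅ h₆ h₇ x y z := by
    obtain ⟨x, rfl⟩ := Submodule.mkQ_surjective _ x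
    obtain ⟨y, rfl⟩ := Submodule.mkQ_surjective _ y
    obtain ⟨z, rfl⟩ := Submodule.mkQ_surjective _ z
    simp only [quotComp_mk]
    rw [P.comp_seq a b c d h₁ h₂ h₃ h₄ h₅ h₆ h₇]
  comp_par a b c h₁ h₂ h₃ h₄ h₅ h₆ h₇ h₈ x y z := by
    obtain ⟨x, rfl⟩ := Submodule.mkQ_surjective _ x
    obtain ⟨y, rfl⟩ := Submodule.mkQ_surjective _ y
    obtain ⟨z, rfl⟩ := Submodule.mkQ_surjective _ z
    simp only [quotComp_mk]
    rw [P.comp_par a b c h₁ h₂ h₃ h₄ h₅ h₆ h₇ h₈]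

/-- The projection `P → P / ⟨S⟩`. -/
def proj (P : NSOperad.{u, v} k) (S : ∀ n, Set (P.obj n)) (n : ℕ) :
    P.obj n →ₗ[k] (P.quot S).obj n :=
  (P.ideal S n).mkQ

end NSOperad

/-! ## Decorated planar trees -/

/-- Planar rooted trees whose internal vertices have one or two inputs and are decorated by
elements of `E₁`, respectively `E₂`. -/
inductive PTree (E₁ : Type v₁) (E₂ : Type v₂) : Type (max v₁ v₂)
  | leaf : PTree E₁ E₂
  | un (e : E₁) (t : PTree E₁ E₂) : PTree E₁ E₂
  | bin (e : E₂) (s t : PTree E₁ E₂) : PTree E₁ E₂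

namespace PTree

variable {E₁ : Type v₁} {E₂ : Type v₂}

/-- The number of leaves. -/
def leaves : PTree E₁ E₂ → ℕ
  | leaf => 1
  | un _ t => t.leaves
  | bin _ s t => s.leaves + t.leaves

/-- `graft t a s` grafts the root of `s` on the leaf of `t` that has `a` leaves to its left. -/
def graft : PTree E₁ E₂ → ℕ → PTree E₁ E₂ → PTree E₁ E₂
  | leaf, _, s => s
  | un e t, a, s => un e (graft t a s)
  | bin e l r, a, s =>
      if a < l.leaves then bin e (graft l a s) r else bin e l (graft r (a - l.leaves) s)

theorem leaves_graft (t s : PTree E₁ E₂) (a : ℕ) (h : a < t.leaves) :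
    (graft t a s).leaves + 1 = t.leaves + s.leaves := by
  induction t generalizing a with
  | leaf => simp only [graft, leaves]; omega
  | un e t ih => simpa only [graft, leaves] using ih a h
  | bin e l r ihl ihr =>
    simp only [leaves] at h
    simp only [graft]
    split_ifs with hl
    · have := ihl a hl
      simp only [leaves]; omega
    · have := ihr (a - l.leaves) (by omega)
      simp only [leaves]; omega

theorem graft_leaf (t : PTree E₁ E₂) (a : ℕ) : graft t a leaf = t := by
  induction t generalizing a with
  | leaf => rfl
  | un e t ih => simp only [graft, ih]
  | bin e l r ihl ihr => simp only [graft, ihl, ihr, ite_self]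

theorem graft_seq (t s u : PTree E₁ E₂) (a c : ℕ) (ha : a < t.leaves) (hc : c < s.leaves) :
    graft (graft t a s) (a + c) u = graft t a (graft s c u) := by
  induction t generalizing a with
  | leaf =>
    obtain rfl : a = 0 := by simpa only [leaves, Nat.lt_one_iff] using ha
    simp only [graft, Nat.zero_add]
  | un e t ih =>
    simp only [graft]
    rw [ih a ha]
  | bin e l r ihl ihr =>
    simp only [leaves] at ha
    by_cases hl : a < l.leaves
    · have h1 := leaves_graft l s a hl
      simp only [graft, if_pos hl]
      rw [if_pos (by omega), ihl a hl]
    · simp only [graft, if_neg hl]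
      rw [if_neg (by omega), show a + c - l.leaves = (a - l.leaves) + c by omega,
        ihr (a - l.leaves) (by omega)]

theorem graft_par (t s u : PTree E₁ E₂) (a b : ℕ) (h : a + 1 + b < t.leaves) :
    graft (graft t a s) (a + s.leaves + b) u = graft (graft t (a + 1 + b) u) a s := by
  induction t generalizing a b with
  | leaf => simp only [leaves] at h; omega
  | un e t ih =>
    simp only [graft]
    rw [ih a b h]
  | bin e l r ihl ihr =>
    simp only [leaves] at h
    by_cases h1 : a + 1 + b < l.leaves
    · have h2 : a < l.leaves := by omega
      have h3 := leaves_graft l s a h2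
      have h4 := leaves_graft l u (a + 1 + b) h1
      simp only [graft, if_pos h1, if_pos h2]
      rw [if_pos (by omega), if_pos (by omega), ihl a b h1]
    · by_cases h2 : a < l.leaves
      · have h3 := leaves_graft l s a h2
        simp only [graft, if_neg h1, if_pos h2]
        rw [if_neg (by omega),
          show a + s.leaves + b - (l.graft a s).leaves = a + 1 + b - l.leaves by omega]
      · simp only [graft, if_neg h1, if_neg h2]
        rw [if_neg (by omega),
          show a + s.leaves + b - l.leaves = (a - l.leaves) + s.leaves + b by omega,
          ihr (a - l.leaves) b (by omega),
          show a - l.leaves + 1 + b = a + 1 + b - l.leaves by omega]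

variable (E₁ E₂) in
/-- Trees with `n` leaves. -/
abbrev OfArity (n : ℕ) : Type (max v₁ v₂) := {t : PTree E₁ E₂ // t.leaves = n}

theorem leaves_leaf : (leaf : PTree E₁ E₂).leaves = 1 := rfl

theorem leaves_corollaUn (e : E₁) : (un e leaf : PTree E₁ E₂).leaves = 1 := rfl

theorem leaves_corollaBin (e : E₂) : (bin e leaf leaf : PTree E₁ E₂).leaves = 2 := rfl

/-- Grafting, with the numbers of leaves recorded in the types. -/
def graftOf {m n r : ℕ} (a b : ℕ) (h : m = a + 1 + b) (h' : r = a + n + b)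
    (t : OfArity E₁ E₂ m) (s : OfArity E₁ E₂ n) : OfArity E₁ E₂ r :=
  ⟨graft t.1 a s.1, by
    have h1 := leaves_graft t.1 s.1 a (by rw [t.2]; omega)
    rw [t.2, s.2] at h1
    omega⟩

end PTree

/-! ## The free operad on generators in arities one and two -/

section Free

variable (k : Type u) [Field k] (E₁ : Type v₁) (E₂ : Type v₂)

/-- Bilinear extension of grafting to linear combinations of trees. -/
noncomputable def treeComp {m n r : ℕ} (a b : ℕ) (h : m = a + 1 + b) (h' : r = a + n + b) :
    (PTree.OfArity E₁ E₂ m →₀ k) →ₗ[k] (PTree.OfArity E₁ E₂ n →₀ k) →ₗ[k]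
      (PTree.OfArity E₁ E₂ r →₀ k) :=
  Finsupp.lift _ k _ (fun t => Finsupp.lmapDomain k k (PTree.graftOf a b h h' t))

variable {k E₁ E₂} in
theorem treeComp_single {m n r : ℕ} (a b : ℕ) (h : m = a + 1 + b) (h' : r = a + n + b)
    (t : PTree.OfArity E₁ E₂ m) (s : PTree.OfArity E₁ E₂ n) (c d : k) :
    treeComp k E₁ E₂ a b h h' (Finsupp.single t c) (Finsupp.single s d)
      = Finsupp.single (PTree.graftOf a b h h' t s) (c * d) := by
  simp [treeComp, Finsupp.mapDomain_single]

/-- The operad of formal linear combinations of decorated trees, with grafting as composition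
(not yet linear in the decorations). -/
noncomputable abbrev treeOperad : NSOperad.{u, max u v₁ v₂} k where
  obj n := PTree.OfArity E₁ E₂ n →₀ k
  addCommGroup _ := inferInstance
  module _ := inferInstance
  one := Finsupp.single ⟨PTree.leaf, PTree.leaves_leaf⟩ 1
  comp a b h h' := treeComp k E₁ E₂ a b h h'
  one_comp h h' x := by
    induction x using Finsupp.induction_linear with
    | zero => simp
    | add f g hf hg => rw [map_add, hf, hg]
    | single t c =>
      rw [treeComp_single, one_mul]
      rfl
  comp_one a b h h' x := by
    induction x using Finsupp.induction_linear with
    | zero => simp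
    | add f g hf hg => rw [map_add, LinearMap.add_apply, hf, hg]
    | single t c =>
      rw [treeComp_single, mul_one]
      congr 1
      exact Subtype.ext (PTree.graft_leaf _ _)
  comp_seq a b c d h₁ h₂ h₃ h₄ h₅ h₆ h₇ x y z := by
    induction x using Finsupp.induction_linear with
    | zero => simp
    | add f g hf hg => simp only [map_add, LinearMap.add_apply, hf, hg]
    | single t c₁ =>
      induction y using Finsupp.induction_linear with
      | zero => simp
      | add f g hf hg => simp only [map_add, LinearMap.add_apply, hf, hg]
      | single s c₂ =>
        induction z using Finsupp.induction_linear with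
        | zero => simp
        | add f g hf hg => simp only [map_add, hf, hg]
        | single u c₃ =>
          simp only [treeComp_single, mul_assoc]
          congr 1
          refine Subtype.ext (PTree.graft_seq _ _ _ _ _ ?_ ?_)
          · rw [t.2]; omega
          · rw [s.2]; omega
  comp_par a b c h₁ h₂ h₃ h₄ h₅ h₆ h₇ h₈ x y z := by
    induction x using Finsupp.induction_linear with
    | zero => simp
    | add f g hf hg => simp only [map_add, LinearMap.add_apply, hf, hg]
    | single t c₁ =>
      induction y using Finsupp.induction_linear with
      | zero => simp
      | add f g hf hg => simp only [map_add, LinearMap.add_apply, hf, hg]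
      | single s c₂ =>
        induction z using Finsupp.induction_linear with
        | zero => simp
        | add f g hf hg => simp only [map_add, LinearMap.add_apply, hf, hg]
        | single u c₃ =>
          simp only [treeComp_single]
          rw [mul_right_comm]
          congr 1
          refine Subtype.ext ?_
          have h := PTree.graft_par t.1 s.1 u.1 a b (by rw [t.2]; omega)
          rw [s.2] at h
          exact h

variable {E₁ E₂}

/-- The corolla with one input decorated by `e`. -/
noncomputable def corollaUn (E₂ : Type v₂) (e : E₁) : (treeOperad k E₁ E₂).obj 1 :=
  Finsupp.single (⟨PTree.un e PTree.leaf, PTree.leaves_corollaUn e⟩ : PTree.OfArity E₁ E₂ 1) (1 : k)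

/-- The corolla with two inputs decorated by `e`. -/
noncomputable def corollaBin (E₁ : Type v₁) (e : E₂) : (treeOperad k E₁ E₂).obj 2 :=
  Finsupp.single
    (⟨PTree.bin e PTree.leaf PTree.leaf, PTree.leaves_corollaBin e⟩ : PTree.OfArity E₁ E₂ 2) (1 : k)

variable (E₁ E₂) [AddCommGroup E₁] [Module k E₁] [AddCommGroup E₂] [Module k E₂]

/-- Linearity of the corollas in their decorations. -/
inductive LinRel : ∀ n, (treeOperad k E₁ E₂).obj n → Prop
  | un_add (e e' : E₁) :
      LinRel 1 (corollaUn k E₂ (e + e') - (corollaUn k E₂ e + corollaUn k E₂ e'))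
  | un_smul (c : k) (e : E₁) : LinRel 1 (corollaUn k E₂ (c • e) - c • corollaUn k E₂ e)
  | bin_add (e e' : E₂) :
      LinRel 2 (corollaBin k E₁ (e + e') - (corollaBin k E₁ e + corollaBin k E₁ e'))
  | bin_smul (c : k) (e : E₂) : LinRel 2 (corollaBin k E₁ (c • e) - c • corollaBin k E₁ e)

/-- The family of sets of linearity relations. -/
def linRelSet (n : ℕ) : Set ((treeOperad k E₁ E₂).obj n) := {x | LinRel k E₁ E₂ n x}

/-- The free ns operad `𝒯(E)` on `E = {0, E₁, E₂, 0, …}`: trees decorated by elements of `E`,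
multilinear in the decorations. -/
noncomputable abbrev freeOperad : NSOperad.{u, max u v₁ v₂} k :=
  (treeOperad k E₁ E₂).quot (linRelSet k E₁ E₂)

/-- The embedding `E₁ → 𝒯(E)₁`. -/
noncomputable def freeUn : E₁ →ₗ[k] (freeOperad k E₁ E₂).obj 1 where
  toFun e := (treeOperad k E₁ E₂).proj (linRelSet k E₁ E₂) 1 (corollaUn k E₂ e)
  map_add' e e' :=
    (Submodule.Quotient.eq _).2 (NSOperad.InIdeal.of (LinRel.un_add e e'))
  map_smul' c e :=
    (Submodule.Quotient.eq _).2 (NSOperad.InIdeal.of (LinRel.un_smul c e))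

/-- The embedding `E₂ → 𝒯(E)₂`. -/
noncomputable def freeBin : E₂ →ₗ[k] (freeOperad k E₁ E₂).obj 2 where
  toFun e := (treeOperad k E₁ E₂).proj (linRelSet k E₁ E₂) 2 (corollaBin k E₁ e)
  map_add' e e' :=
    (Submodule.Quotient.eq _).2 (NSOperad.InIdeal.of (LinRel.bin_add e e'))
  map_smul' c e :=
    (Submodule.Quotient.eq _).2 (NSOperad.InIdeal.of (LinRel.bin_smul c e))

/-- The weight two part of `𝒯(E)` in arity one: `α ⊗ β ↦ α ∘₁ β`. -/
noncomputable def quadTree₁ : E₁ ⊗[k] E₁ →ₗ[k] (freeOperad k E₁ E₂).obj 1 :=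
  TensorProduct.lift
    (((freeOperad k E₁ E₂).comp 0 0 rfl rfl).compl₁₂ (freeUn k E₁ E₂) (freeUn k E₁ E₂))

/-- The weight two part of `𝒯(E)` in arity two:
`(α ⊗ μ, μ' ⊗ α', μ'' ⊗ α'') ↦ α ∘₁ μ + μ' ∘₁ α' + μ'' ∘₂ α''`. -/
noncomputable def quadTree₂ :
    (E₁ ⊗[k] E₂) × (E₂ ⊗[k] E₁) × (E₂ ⊗[k] E₁) →ₗ[k] (freeOperad k E₁ E₂).obj 2 :=
  (TensorProduct.lift
    (((freeOperad k E₁ E₂).comp 0 0 rfl rfl).compl₁₂ (freeUn k E₁ E₂) (freeBin k E₁ E₂))).coprod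
  ((TensorProduct.lift
    (((freeOperad k E₁ E₂).comp 0 1 rfl rfl).compl₁₂ (freeBin k E₁ E₂) (freeUn k E₁ E₂))).coprod
  (TensorProduct.lift
    (((freeOperad k E₁ E₂).comp 1 0 rfl rfl).compl₁₂ (freeBin k E₁ E₂) (freeUn k E₁ E₂))))

/-- The weight two part of `𝒯(E)` in arity three:
`(μ ⊗ ν, μ' ⊗ ν') ↦ μ ∘₁ ν + μ' ∘₂ ν'`. -/
noncomputable def quadTree₃ :
    (E₂ ⊗[k] E₂) × (E₂ ⊗[k] E₂) →ₗ[k] (freeOperad k E₁ E₂).obj 3 :=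
  (TensorProduct.lift
    (((freeOperad k E₁ E₂).comp 0 1 rfl rfl).compl₁₂ (freeBin k E₁ E₂) (freeBin k E₁ E₂))).coprod
  (TensorProduct.lift
    (((freeOperad k E₁ E₂).comp 1 0 rfl rfl).compl₁₂ (freeBin k E₁ E₂) (freeBin k E₁ E₂)))

end Free

/-! ## Unary binary quadratic operads, matching operads and Koszul duals -/

/-- Quadratic relations on the generators `E = {0, E₁, E₂, 0, …}`, in arities one, two and three,
as subspaces of the weight two part of `𝒯(E)`. -/
@[ext]
structure QuadRel (k : Type u) [Field k] (E₁ : Type v₁) (E₂ : Type v₂)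
    [AddCommGroup E₁] [Module k E₁] [AddCommGroup E₂] [Module k E₂] where
  R₁ : Submodule k (E₁ ⊗[k] E₁)
  R₂ : Submodule k ((E₁ ⊗[k] E₂) × (E₂ ⊗[k] E₁) × (E₂ ⊗[k] E₁))
  R₃ : Submodule k ((E₂ ⊗[k] E₂) × (E₂ ⊗[k] E₂))

namespace QuadRel

variable {k : Type u} [Field k] {E₁ : Type v₁} {E₂ : Type v₂}
  [AddCommGroup E₁] [Module k E₁] [AddCommGroup E₂] [Module k E₂]

/-- The relations as elements of the free operad. -/
inductive InFree (R : QuadRel k E₁ E₂) : ∀ n, (freeOperad k E₁ E₂).obj n → Prop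
  | rel₁ (r : E₁ ⊗[k] E₁) : r ∈ R.R₁ → InFree R 1 (quadTree₁ k E₁ E₂ r)
  | rel₂ (r : (E₁ ⊗[k] E₂) × (E₂ ⊗[k] E₁) × (E₂ ⊗[k] E₁)) :
      r ∈ R.R₂ → InFree R 2 (quadTree₂ k E₁ E₂ r)
  | rel₃ (r : (E₂ ⊗[k] E₂) × (E₂ ⊗[k] E₂)) : r ∈ R.R₃ → InFree R 3 (quadTree₃ k E₁ E₂ r)

/-- The relations, as a family of subsets of the free operad. -/
def toSet (R : QuadRel k E₁ E₂) (n : ℕ) : Set ((freeOperad k E₁ E₂).obj n) :=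
  {x | R.InFree n x}

/-- The unary binary quadratic ns operad `𝒫(E, R) = 𝒯(E) / ⟨R⟩`. -/
noncomputable abbrev operad (R : QuadRel k E₁ E₂) : NSOperad.{u, max u v₁ v₂} k :=
  (freeOperad k E₁ E₂).quot R.toSet

/-- The class of a unary generator. -/
noncomputable def genUn (R : QuadRel k E₁ E₂) : E₁ →ₗ[k] R.operad.obj 1 :=
  (freeOperad k E₁ E₂).proj R.toSet 1 ∘ₗ freeUn k E₁ E₂

/-- The class of a binary generator. -/
noncomputable def genBin (R : QuadRel k E₁ E₂) : E₂ →ₗ[k] R.operad.obj 2 :=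
  (freeOperad k E₁ E₂).proj R.toSet 2 ∘ₗ freeBin k E₁ E₂

section Matching

variable {Ω : Type w}

/-- Replication `R₁ → R₁^{μ,ν}`: in `α ∘₁ β`, the upper vertex `β` is replaced by its copy with
index `μ`, the root vertex `α` by its copy with index `ν`. -/
noncomputable def rep₁ (μ ν : Ω) : E₁ ⊗[k] E₁ →ₗ[k] (Ω →₀ E₁) ⊗[k] (Ω →₀ E₁) :=
  TensorProduct.map (Finsupp.lsingle ν) (Finsupp.lsingle μ)

/-- Replication `R₂ → R₂^{μ,ν}`: unary operations get the index `μ`, binary ones the index `ν`. -/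
noncomputable def rep₂ (μ ν : Ω) :
    (E₁ ⊗[k] E₂) × (E₂ ⊗[k] E₁) × (E₂ ⊗[k] E₁) →ₗ[k]
      ((Ω →₀ E₁) ⊗[k] (Ω →₀ E₂)) × ((Ω →₀ E₂) ⊗[k] (Ω →₀ E₁)) × ((Ω →₀ E₂) ⊗[k] (Ω →₀ E₁)) :=
  (TensorProduct.map (Finsupp.lsingle μ) (Finsupp.lsingle ν)).prodMap
    ((TensorProduct.map (Finsupp.lsingle ν) (Finsupp.lsingle μ)).prodMap
      (TensorProduct.map (Finsupp.lsingle ν) (Finsupp.lsingle μ)))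

/-- Replication `R₃ → R₃^{μ,ν}`: in `(x ∗ y) ⋆ z` and in `x ∗ (y ⋆ z)` alike, `∗` gets the index
`μ` and `⋆` gets the index `ν`. So in `α ∘₁ β` the root vertex `α` gets `ν` and `β` gets `μ`,
while in `α ∘₂ β` the root vertex `α` gets `μ` and `β` gets `ν`. -/
noncomputable def rep₃ (μ ν : Ω) :
    (E₂ ⊗[k] E₂) × (E₂ ⊗[k] E₂) →ₗ[k]
      ((Ω →₀ E₂) ⊗[k] (Ω →₀ E₂)) × ((Ω →₀ E₂) ⊗[k] (Ω →₀ E₂)) :=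
  (TensorProduct.map (Finsupp.lsingle ν) (Finsupp.lsingle μ)).prodMap
    (TensorProduct.map (Finsupp.lsingle μ) (Finsupp.lsingle ν))

variable (Ω) in
/-- The relations of the matching operad: the generators are the direct sums over `Ω` of copies
of `E₁` and `E₂`, the relations are all the replicas `R_i^{μ,ν}`. -/
noncomputable def mat (R : QuadRel k E₁ E₂) : QuadRel k (Ω →₀ E₁) (Ω →₀ E₂) where
  R₁ := ⨆ (μ : Ω) (ν : Ω), R.R₁.map (rep₁ μ ν)
  R₂ := ⨆ (μ : Ω) (ν : Ω), R.R₂.map (rep₂ μ ν)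
  R₃ := ⨆ (μ : Ω) (ν : Ω), R.R₃.map (rep₃ μ ν)

end Matching

section Koszul

variable (k E₁ E₂)

/-- `⟨α* ∘₁ β*, α ∘₁ β⟩ = α*(α) β*(β)`. -/
noncomputable def pair₁ :
    Module.Dual k E₁ ⊗[k] Module.Dual k E₁ →ₗ[k] Module.Dual k (E₁ ⊗[k] E₁) :=
  TensorProduct.dualDistrib k E₁ E₁

/-- `⟨α* ∘₁ μ*, α ∘₁ μ⟩ = -α*(α) μ*(μ)`, `⟨μ* ∘₁ α*, μ ∘₁ α⟩ = μ*(μ) α*(α)`,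
`⟨μ* ∘₂ α*, μ ∘₂ α⟩ = μ*(μ) α*(α)`, and zero between trees of different shapes. -/
noncomputable def pair₂ :
    (Module.Dual k E₁ ⊗[k] Module.Dual k E₂) × (Module.Dual k E₂ ⊗[k] Module.Dual k E₁) ×
        (Module.Dual k E₂ ⊗[k] Module.Dual k E₁) →ₗ[k]
      Module.Dual k ((E₁ ⊗[k] E₂) × (E₂ ⊗[k] E₁) × (E₂ ⊗[k] E₁)) where
  toFun ξ := (-TensorProduct.dualDistrib k E₁ E₂ ξ.1).coprod
    ((TensorProduct.dualDistrib k E₂ E₁ ξ.2.1).coprod (TensorProduct.dualDistrib k E₂ E₁ ξ.2.2))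
  map_add' ξ η := by
    refine LinearMap.ext fun r => ?_
    simp
    ring
  map_smul' c ξ := by
    refine LinearMap.ext fun r => ?_
    simp
    ring

/-- `⟨μ* ∘₁ ν*, μ ∘₁ ν⟩ = μ*(μ) ν*(ν)`, `⟨μ* ∘₂ ν*, μ ∘₂ ν⟩ = -μ*(μ) ν*(ν)`,
and zero between trees of different shapes. -/
noncomputable def pair₃ :
    (Module.Dual k E₂ ⊗[k] Module.Dual k E₂) × (Module.Dual k E₂ ⊗[k] Module.Dual k E₂) →ₗ[k]
      Module.Dual k ((E₂ ⊗[k] E₂) × (E₂ ⊗[k] E₂)) where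
  toFun ξ := (TensorProduct.dualDistrib k E₂ E₂ ξ.1).coprod
    (-TensorProduct.dualDistrib k E₂ E₂ ξ.2)
  map_add' ξ η := by
    refine LinearMap.ext fun r => ?_
    simp
    ring
  map_smul' c ξ := by
    refine LinearMap.ext fun r => ?_
    simp
    ring

variable {k E₁ E₂}

/-- The relations `R^⊥` of the Koszul dual operad `𝒫^! = 𝒯(E^*) / ⟨R^⊥⟩`. -/
noncomputable def koszulDual (R : QuadRel k E₁ E₂) :
    QuadRel k (Module.Dual k E₁) (Module.Dual k E₂) where
  R₁ := R.R₁.dualAnnihilator.comap (pair₁ k E₁)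
  R₂ := R.R₂.dualAnnihilator.comap (pair₂ k E₁ E₂)
  R₃ := R.R₃.dualAnnihilator.comap (pair₃ k E₂)

/-- The operad `𝒫(E, R)` is self-dual: it is isomorphic to its Koszul dual operad. -/
def IsSelfDual (R : QuadRel k E₁ E₂) : Prop :=
  Nonempty (NSOperad.Iso R.operad R.koszulDual.operad)

end Koszul

end QuadRel

-- Duality. For each shape of weight two tree, the pair (μ, ν) fixes the indices of both vertices,
-- and every pair of indices arises from exactly one (μ, ν). Hence, for finite Ω, the weight two
-- part on the replicated generators is a direct sum of Ω × Ω copies of the original one, and the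
-- relations of the matching operad are the direct sum of the copies of `R`: an element is a
-- relation iff all its components are (`mem_mat₁_iff`, `mem_mat₂_iff`, `mem_mat₃_iff`). The pairing
-- is an orthogonal sum of copies of the original pairing, because the indices are placed in the
-- same way on both sides and the signs depend only on the shape (`dualDistrib_map_sumDual`). So the
-- annihilator of the sum is the sum of the annihilators, which is `koszulDual_mat_R₁` and its two
-- analogues.
--
-- Self-duality. An isomorphism of presentations replicates to the matching presentations
-- (`Compat.mat`), but self-duality only provides an isomorphism of operads, which may ignore
-- weight: a unary generator may go to a scalar multiple of the identity plus a linear part plus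
-- terms of higher weight. The main point is that an isomorphism of presentations can still be
-- extracted (`exists_linear_part`, `exists_compat_of_iso`). Project the target to its truncation in
-- weights at most two. Surjectivity forces the linear parts f, g of the values on generators to be
-- surjective, hence bijective since the generators have equal dimensions. The weight one part of
-- the image of a relation r is the linear part of the contraction of r by the scalars, so this
-- contraction is zero; then the weight two part says that f and g send r to a relation. The inverse
-- isomorphism bounds the dimensions of the relation spaces the other way, so f and g match the
-- relations exactly.
--
-- Morphisms out of a presented operad are built by evaluating trees (`PTree.eval_graft`), and they
-- are determined by the generators (`hom_ext`).

universe w₁ w₂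

/-! ### Morphisms and isomorphisms of ns operads -/

namespace NSOperad

variable {k : Type u} [Field k]

/-- Positions obtained from different trees agree only up to arithmetic. As the arity equations are
arguments of `comp`, positions can be exchanged without transporting elements. -/
theorem comp_congr (P : NSOperad.{u, v} k) {m n r a b a' b' : ℕ} (ha : a = a') (hb : b = b')
    (h : m = a + 1 + b) (h' : r = a + n + b) (x : P.obj m) (y : P.obj n) :
    P.comp a b h h' x y = P.comp a' b' (by omega) (by omega) x y := by
  subst ha hb; rfl

/-- Morphisms of ns operads. -/
structure Hom (P : NSOperad.{u, v} k) (Q : NSOperad.{u, w} k) where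
  map : ∀ n, P.obj n →ₗ[k] Q.obj n
  map_one : map 1 P.one = Q.one
  map_comp : ∀ {m n r : ℕ} (a b : ℕ) (h : m = a + 1 + b) (h' : r = a + n + b)
    (x : P.obj m) (y : P.obj n),
    map r (P.comp a b h h' x y) = Q.comp a b h h' (map m x) (map n y)

namespace Hom

variable {P : NSOperad.{u, v} k} {Q : NSOperad.{u, w} k} {T : NSOperad.{u, w₁} k}

/-- The identity morphism. -/
def id (P : NSOperad.{u, v} k) : Hom P P where
  map _ := LinearMap.id
  map_one := rfl
  map_comp _ _ _ _ _ _ := rfl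

/-- Composition of morphisms. -/
def comp (g : Hom Q T) (f : Hom P Q) : Hom P T where
  map n := g.map n ∘ₗ f.map n
  map_one := by simp [f.map_one, g.map_one]
  map_comp a b h h' x y := by simp [f.map_comp, g.map_comp]

/-- The kernel of a morphism is closed under everything that generates an operadic ideal. -/
theorem map_eq_zero_of_inIdeal (f : Hom P Q) {S : ∀ n, Set (P.obj n)}
    (hS : ∀ n, ∀ x ∈ S n, f.map n x = 0) {n : ℕ} {x : P.obj n} (hx : InIdeal P S n x) :
    f.map n x = 0 := by
  induction hx with
  | of h => exact hS _ _ h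
  | zero => exact map_zero _
  | add _ _ h₁ h₂ => rw [map_add, h₁, h₂, add_zero]
  | smul c _ h => rw [map_smul, h, smul_zero]
  | comp_left a b h h' y _ ih => rw [f.map_comp, ih, map_zero, LinearMap.zero_apply]
  | comp_right a b h h' x _ ih => rw [f.map_comp, ih, map_zero]

/-- Factorization of a morphism through a quotient operad. -/
def quotLift (f : Hom P Q) (S : ∀ n, Set (P.obj n)) (hS : ∀ n, ∀ x ∈ S n, f.map n x = 0) :
    Hom (P.quot S) Q where
  map n := (P.ideal S n).liftQ (f.map n) (fun _ hx => f.map_eq_zero_of_inIdeal hS hx)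
  map_one := f.map_one
  map_comp a b h h' x y := by
    obtain ⟨x, rfl⟩ := Submodule.mkQ_surjective _ x
    obtain ⟨y, rfl⟩ := Submodule.mkQ_surjective _ y
    exact f.map_comp a b h h' x y

end Hom

/-- The morphism underlying an isomorphism. -/
def Iso.toHom {P : NSOperad.{u, v} k} {Q : NSOperad.{u, w} k} (e : Iso P Q) : Hom P Q where
  map n := (e.equiv n).toLinearMap
  map_one := e.map_one
  map_comp := e.map_comp

/-- The inverse isomorphism. -/
def Iso.symm {P : NSOperad.{u, v} k} {Q : NSOperad.{u, w} k} (e : Iso P Q) : Iso Q P where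
  equiv n := (e.equiv n).symm
  map_one := by rw [← e.map_one, LinearEquiv.symm_apply_apply]
  map_comp a b h h' x y := by
    rw [LinearEquiv.symm_apply_eq, e.map_comp, LinearEquiv.apply_symm_apply,
      LinearEquiv.apply_symm_apply]

/-- Composition of isomorphisms. -/
def Iso.trans {P : NSOperad.{u, v} k} {Q : NSOperad.{u, w} k} {T : NSOperad.{u, w₁} k}
    (e : Iso P Q) (f : Iso Q T) : Iso P T where
  equiv n := (e.equiv n).trans (f.equiv n)
  map_one := by simp [e.map_one, f.map_one]
  map_comp a b h h' x y := by simp [e.map_comp, f.map_comp]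

/-- Two mutually inverse morphisms form an isomorphism. -/
def Iso.ofHom {P : NSOperad.{u, v} k} {Q : NSOperad.{u, w} k} (f : Hom P Q) (g : Hom Q P)
    (h₁ : ∀ n x, g.map n (f.map n x) = x) (h₂ : ∀ n x, f.map n (g.map n x) = x) : Iso P Q where
  equiv n := LinearEquiv.ofLinearMap (f.map n) (g.map n) (LinearMap.ext (h₂ n)) (LinearMap.ext (h₁ n))
  map_one := f.map_one
  map_comp := f.map_comp

end NSOperad

/-! ### Evaluation of trees in an operad -/

namespace PTree

variable {k : Type u} [Field k] {E₁ : Type v₁} {E₂ : Type v₂} (P : NSOperad.{u, w} k)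
  (f : E₁ → P.obj 1) (g : E₂ → P.obj 2)

/-- Evaluation of a tree in an operad, given the values of the corollas. -/
def eval : (t : PTree E₁ E₂) → (n : ℕ) → t.leaves = n → P.obj n
  | leaf, _, h => h ▸ P.one
  | un e t, n, h => P.comp 0 0 rfl (by simp) (f e) (eval t n h)
  | bin e s t, _, h =>
      P.comp 0 t.leaves (by omega) (by simp only [leaves] at h; omega)
        (P.comp (r := 1 + t.leaves) 1 0 rfl (by omega) (g e) (eval t t.leaves rfl))
        (eval s s.leaves rfl)

theorem eval_congr {t t' : PTree E₁ E₂} (ht : t = t') (n : ℕ) (h : t.leaves = n) :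
    eval P f g t n h = eval P f g t' n (ht ▸ h) := by
  subst ht; rfl

/-- The right subtree is plugged in first, so that the left one still goes into position 0. The leaf
counts are variables here, to accept whatever form they take after a grafting. -/
theorem eval_bin (e : E₂) (s t : PTree E₁ E₂) (i j n : ℕ) (hs : s.leaves = i) (ht : t.leaves = j)
    (h : (bin e s t).leaves = n) :
    eval P f g (bin e s t) n h = P.comp 0 j (by omega) (by simp only [leaves] at h; omega)
      (P.comp (r := 1 + j) 1 0 rfl (by omega) (g e) (eval P f g t j ht))
        (eval P f g s i hs) := by
  subst hs ht; rfl

/-- Evaluation turns grafting into composition. Grafting above a unary vertex or into a left subtree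
is sequential associativity; grafting into a right subtree also needs the parallel axiom. -/
theorem eval_graft (t s : PTree E₁ E₂) {m n r : ℕ} (a b : ℕ) (ht : t.leaves = m)
    (hs : s.leaves = n) (hr : (graft t a s).leaves = r) (h : m = a + 1 + b) (h' : r = a + n + b) :
    eval P f g (graft t a s) r hr
      = P.comp a b h h' (eval P f g t m ht) (eval P f g s n hs) := by
  induction t generalizing a b m r with
  | leaf =>
    simp only [leaves] at ht
    subst ht
    obtain rfl : a = 0 := by omega
    obtain rfl : b = 0 := by omega
    obtain rfl : r = n := by omega
    exact (P.one_comp h h' _).symm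
  | un e t ih =>
    simp only [graft, eval]
    rw [ih a b ht hr h h', ← P.comp_seq 0 0 a b (p := m) rfl (by omega) (by omega) (by omega) h h'
      (by omega)]
    exact P.comp_congr (by omega) (by omega) _ _ _ _
  | bin e l q ihl ihq =>
    have hlq : l.leaves + q.leaves = m := ht
    by_cases hl : a < l.leaves
    · have hg : graft (bin e l q) a s = bin e (graft l a s) q := by simp only [graft, if_pos hl]
      have h1 := leaves_graft l s a hl
      rw [eval_congr P f g hg, eval_bin P f g e _ q _ q.leaves r rfl rfl,
        eval_bin P f g e l q l.leaves q.leaves m rfl rfl,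
        ihl a (l.leaves - a - 1) rfl rfl (by omega) (by omega),
        ← P.comp_seq 0 q.leaves a (l.leaves - a - 1) (p := m) (by omega) (by omega) (by omega)
          (by omega)]
      exact P.comp_congr (by omega) (by omega) _ _ _ _
    · have hg : graft (bin e l q) a s = bin e l (graft q (a - l.leaves) s) := by
        simp only [graft, if_neg hl]
      have h1 := leaves_graft q s (a - l.leaves) (by omega)
      rw [eval_congr P f g hg, eval_bin P f g e l _ l.leaves _ r rfl rfl,
        eval_bin P f g e l q l.leaves q.leaves m rfl rfl,
        ihq (a - l.leaves) b rfl rfl (by omega) (by omega),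
        ← P.comp_seq 1 0 (a - l.leaves) b (p := 1 + q.leaves) (by omega) (by omega) (by omega)
          (by omega)]
      -- After `comp_seq`, one side inserts `s` before `l` and the other inserts `l` before `s`. The
      -- two go into different inputs, so the parallel axiom exchanges them.
      have := P.comp_par (l := 1 + q.leaves) (m := l.leaves) (n := n) (p := m) (r := r)
        (q := 1 + (graft q (a - l.leaves) s).leaves)
        0 (a - l.leaves) b (by omega) (by omega) (by omega) (by omega) (by omega) (by omega)
        (by omega) (by omega)
        (P.comp (r := 1 + q.leaves) 1 0 rfl (by omega) (g e) (eval P f g q q.leaves rfl))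
        (eval P f g l l.leaves rfl) (eval P f g s n hs)
      rw [P.comp_congr (a' := a) (b' := b) (by omega) rfl] at this
      rw [P.comp_congr (a := 0) (a' := 0) (b' := q.leaves) rfl (by omega)] at this
      rw [this, P.comp_congr (a := 0) (a' := 0) (b' := a - l.leaves + n + b) rfl (by omega)]
      congr 2

end PTree

/-! ### Universal property of the free operad -/

section Universal

variable {k : Type u} [Field k] {E₁ : Type v₁} {E₂ : Type v₂} {P : NSOperad.{u, w} k}

/-- The morphism out of the operad of decorated trees with given values on corollas. -/
noncomputable def treeLift (f : E₁ → P.obj 1) (g : E₂ → P.obj 2) :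
    NSOperad.Hom (treeOperad k E₁ E₂) P where
  map n := Finsupp.linearCombination k (fun t : PTree.OfArity E₁ E₂ n => t.1.eval P f g n t.2)
  map_one := by
    rw [Finsupp.linearCombination_single, one_smul]
    rfl
  map_comp a b h h' x y := by
    induction x using Finsupp.induction_linear with
    | zero => simp
    | add x x' hx hx' => simp only [map_add, LinearMap.add_apply, hx, hx']
    | single t c =>
      induction y using Finsupp.induction_linear with
      | zero => simp
      | add y y' hy hy' => simp only [map_add, hy, hy']
      | single s d =>
        simp only [treeComp_single, Finsupp.linearCombination_single, map_smul,
          LinearMap.smul_apply, smul_smul]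
        rw [mul_comm c d]
        congr 1
        exact PTree.eval_graft P f g t.1 s.1 a b t.2 s.2 _ h h'

theorem treeLift_corollaUn (f : E₁ → P.obj 1) (g : E₂ → P.obj 2) (e : E₁) :
    (treeLift f g).map 1 (corollaUn k E₂ e) = f e := by
  simp only [treeLift, corollaUn, Finsupp.linearCombination_single, one_smul]
  exact P.comp_one 0 0 rfl rfl (f e)

theorem treeLift_corollaBin (f : E₁ → P.obj 1) (g : E₂ → P.obj 2) (e : E₂) :
    (treeLift f g).map 2 (corollaBin k E₁ e) = g e := by
  simp only [treeLift, corollaBin, Finsupp.linearCombination_single, one_smul]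
  rw [PTree.eval_bin P f g e _ _ 1 1 2 rfl rfl]
  change P.comp 0 1 _ _ (P.comp (r := 2) 1 0 _ _ (g e) P.one) P.one = g e
  rw [P.comp_one]
  exact P.comp_one 1 0 rfl rfl (g e)

variable [AddCommGroup E₁] [Module k E₁] [AddCommGroup E₂] [Module k E₂]

/-- The universal property of the free operad. -/
noncomputable def freeLift (f : E₁ →ₗ[k] P.obj 1) (g : E₂ →ₗ[k] P.obj 2) :
    NSOperad.Hom (freeOperad k E₁ E₂) P :=
  (treeLift f g).quotLift _ (by
    rintro _ _ (⟨e, e'⟩ | ⟨c, e⟩ | ⟨e, e'⟩ | ⟨c, e⟩)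
    all_goals refine (map_sub _ _ _).trans (sub_eq_zero.2 ?_)
    · refine ((treeLift_corollaUn f g _).trans (map_add f e e')).trans
        (Eq.trans ?_ (map_add _ _ _).symm)
      rw [treeLift_corollaUn, treeLift_corollaUn]
    · refine ((treeLift_corollaUn f g _).trans (map_smul f c e)).trans
        (Eq.trans ?_ (map_smul _ _ _).symm)
      rw [treeLift_corollaUn]
    · refine ((treeLift_corollaBin f g _).trans (map_add g e e')).trans
        (Eq.trans ?_ (map_add _ _ _).symm)
      rw [treeLift_corollaBin, treeLift_corollaBin]
    · refine ((treeLift_corollaBin f g _).trans (map_smul g c e)).trans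
        (Eq.trans ?_ (map_smul _ _ _).symm)
      rw [treeLift_corollaBin])

theorem freeLift_freeUn (f : E₁ →ₗ[k] P.obj 1) (g : E₂ →ₗ[k] P.obj 2) (e : E₁) :
    (freeLift f g).map 1 (freeUn k E₁ E₂ e) = f e :=
  treeLift_corollaUn f g e

theorem freeLift_freeBin (f : E₁ →ₗ[k] P.obj 1) (g : E₂ →ₗ[k] P.obj 2) (e : E₂) :
    (freeLift f g).map 2 (freeBin k E₁ E₂ e) = g e :=
  treeLift_corollaBin f g e

variable (P) in
/-- The value of a weight two element of arity one, given the values of the generators. -/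
noncomputable def quadEval₁ (f : E₁ →ₗ[k] P.obj 1) : E₁ ⊗[k] E₁ →ₗ[k] P.obj 1 :=
  TensorProduct.lift ((P.comp 0 0 rfl rfl).compl₁₂ f f)

variable (P) in
/-- The value of a weight two element of arity two, given the values of the generators. -/
noncomputable def quadEval₂ (f : E₁ →ₗ[k] P.obj 1) (g : E₂ →ₗ[k] P.obj 2) :
    (E₁ ⊗[k] E₂) × (E₂ ⊗[k] E₁) × (E₂ ⊗[k] E₁) →ₗ[k] P.obj 2 :=
  (TensorProduct.lift ((P.comp 0 0 rfl rfl).compl₁₂ f g)).coprod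
  ((TensorProduct.lift ((P.comp 0 1 rfl rfl).compl₁₂ g f)).coprod
  (TensorProduct.lift ((P.comp 1 0 rfl rfl).compl₁₂ g f)))

variable (P) in
/-- The value of a weight two element of arity three, given the values of the generators. -/
noncomputable def quadEval₃ (g : E₂ →ₗ[k] P.obj 2) :
    (E₂ ⊗[k] E₂) × (E₂ ⊗[k] E₂) →ₗ[k] P.obj 3 :=
  (TensorProduct.lift ((P.comp 0 1 rfl rfl).compl₁₂ g g)).coprod
  (TensorProduct.lift ((P.comp 1 0 rfl rfl).compl₁₂ g g))

/-- A morphism commutes with compositions, so its value on a weight two tree depends only on the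
images of the generators. This lets relations be tested on those images, without trees. -/
theorem hom_quadTree₁ (Φ : NSOperad.Hom (freeOperad k E₁ E₂) P) :
    Φ.map 1 ∘ₗ quadTree₁ k E₁ E₂ = quadEval₁ P (Φ.map 1 ∘ₗ freeUn k E₁ E₂) := by
  ext x y
  exact Φ.map_comp (m := 1) (n := 1) (r := 1) 0 0 rfl rfl (freeUn k E₁ E₂ x) (freeUn k E₁ E₂ y)

theorem hom_quadTree₂ (Φ : NSOperad.Hom (freeOperad k E₁ E₂) P) :
    Φ.map 2 ∘ₗ quadTree₂ k E₁ E₂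
      = quadEval₂ P (Φ.map 1 ∘ₗ freeUn k E₁ E₂) (Φ.map 2 ∘ₗ freeBin k E₁ E₂) := by
  ext x y
  · simpa [quadTree₂, quadEval₂] using
      Φ.map_comp (m := 1) (n := 2) (r := 2) 0 0 rfl rfl (freeUn k E₁ E₂ x) (freeBin k E₁ E₂ y)
  · simpa [quadTree₂, quadEval₂] using
      Φ.map_comp (m := 2) (n := 1) (r := 2) 0 1 rfl rfl (freeBin k E₁ E₂ x) (freeUn k E₁ E₂ y)
  · simpa [quadTree₂, quadEval₂] using
      Φ.map_comp (m := 2) (n := 1) (r := 2) 1 0 rfl rfl (freeBin k E₁ E₂ x) (freeUn k E₁ E₂ y)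

theorem hom_quadTree₃ (Φ : NSOperad.Hom (freeOperad k E₁ E₂) P) :
    Φ.map 3 ∘ₗ quadTree₃ k E₁ E₂ = quadEval₃ P (Φ.map 2 ∘ₗ freeBin k E₁ E₂) := by
  ext x y
  · simpa [quadTree₃, quadEval₃] using
      Φ.map_comp (m := 2) (n := 2) (r := 3) 0 1 rfl rfl (freeBin k E₁ E₂ x) (freeBin k E₁ E₂ y)
  · simpa [quadTree₃, quadEval₃] using
      Φ.map_comp (m := 2) (n := 2) (r := 3) 1 0 rfl rfl (freeBin k E₁ E₂ x) (freeBin k E₁ E₂ y)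

/-! ### Universal property of presented operads -/

namespace QuadRel

/-- The universal property of the operad of a quadratic presentation. -/
noncomputable def lift (R : QuadRel k E₁ E₂) (f : E₁ →ₗ[k] P.obj 1) (g : E₂ →ₗ[k] P.obj 2)
    (h₁ : ∀ r ∈ R.R₁, quadEval₁ P f r = 0) (h₂ : ∀ r ∈ R.R₂, quadEval₂ P f g r = 0)
    (h₃ : ∀ r ∈ R.R₃, quadEval₃ P g r = 0) : NSOperad.Hom R.operad P :=
  (freeLift f g).quotLift _ (by
    have hf : (freeLift f g).map 1 ∘ₗ freeUn k E₁ E₂ = f := LinearMap.ext (freeLift_freeUn f g)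
    have hg : (freeLift f g).map 2 ∘ₗ freeBin k E₁ E₂ = g := LinearMap.ext (freeLift_freeBin f g)
    rintro _ _ (⟨r, hr⟩ | ⟨r, hr⟩ | ⟨r, hr⟩)
    · have := LinearMap.congr_fun (hom_quadTree₁ (freeLift f g)) r
      rw [hf, h₁ r hr] at this
      exact this
    · have := LinearMap.congr_fun (hom_quadTree₂ (freeLift f g)) r
      rw [hf, hg, h₂ r hr] at this
      exact this
    · have := LinearMap.congr_fun (hom_quadTree₃ (freeLift f g)) r
      rw [hg, h₃ r hr] at this
      exact this)

section

variable (R : QuadRel k E₁ E₂) (f : E₁ →ₗ[k] P.obj 1) (g : E₂ →ₗ[k] P.obj 2)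
    (h₁ : ∀ r ∈ R.R₁, quadEval₁ P f r = 0) (h₂ : ∀ r ∈ R.R₂, quadEval₂ P f g r = 0)
    (h₃ : ∀ r ∈ R.R₃, quadEval₃ P g r = 0)

theorem lift_genUn (e : E₁) : (R.lift f g h₁ h₂ h₃).map 1 (R.genUn e) = f e :=
  freeLift_freeUn f g e

theorem lift_genBin (e : E₂) : (R.lift f g h₁ h₂ h₃).map 2 (R.genBin e) = g e :=
  freeLift_freeBin f g e

end

/-- The projection from the free operad. -/
noncomputable def projHom (R : QuadRel k E₁ E₂) : NSOperad.Hom (freeOperad k E₁ E₂) R.operad where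
  map n := (freeOperad k E₁ E₂).proj R.toSet n
  map_one := rfl
  map_comp _ _ _ _ _ _ := rfl

section

variable (R : QuadRel k E₁ E₂) (Φ : NSOperad.Hom R.operad P)

/-- Converse of the hypotheses of `lift`: images of generators satisfy the relations. For the
identity morphism, it says that the relations hold between the generators themselves. -/
theorem hom_rel₁ {r : E₁ ⊗[k] E₁} (hr : r ∈ R.R₁) :
    quadEval₁ P (Φ.map 1 ∘ₗ R.genUn) r = 0 := by
  have h := LinearMap.congr_fun (hom_quadTree₁ (Φ.comp R.projHom)) r
  refine h.symm.trans ?_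
  have : R.projHom.map 1 (quadTree₁ k E₁ E₂ r) = 0 :=
    (Submodule.Quotient.mk_eq_zero _).2 (.of (.rel₁ r hr))
  change Φ.map 1 (R.projHom.map 1 (quadTree₁ k E₁ E₂ r)) = 0
  rw [this, map_zero]

theorem hom_rel₂ {r : (E₁ ⊗[k] E₂) × (E₂ ⊗[k] E₁) × (E₂ ⊗[k] E₁)} (hr : r ∈ R.R₂) :
    quadEval₂ P (Φ.map 1 ∘ₗ R.genUn) (Φ.map 2 ∘ₗ R.genBin) r = 0 := by
  have h := LinearMap.congr_fun (hom_quadTree₂ (Φ.comp R.projHom)) r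
  refine h.symm.trans ?_
  have : R.projHom.map 2 (quadTree₂ k E₁ E₂ r) = 0 :=
    (Submodule.Quotient.mk_eq_zero _).2 (.of (.rel₂ r hr))
  change Φ.map 2 (R.projHom.map 2 (quadTree₂ k E₁ E₂ r)) = 0
  rw [this, map_zero]

theorem hom_rel₃ {r : (E₂ ⊗[k] E₂) × (E₂ ⊗[k] E₂)} (hr : r ∈ R.R₃) :
    quadEval₃ P (Φ.map 2 ∘ₗ R.genBin) r = 0 := by
  have h := LinearMap.congr_fun (hom_quadTree₃ (Φ.comp R.projHom)) r
  refine h.symm.trans ?_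
  have : R.projHom.map 3 (quadTree₃ k E₁ E₂ r) = 0 :=
    (Submodule.Quotient.mk_eq_zero _).2 (.of (.rel₃ r hr))
  change Φ.map 3 (R.projHom.map 3 (quadTree₃ k E₁ E₂ r)) = 0
  rw [this, map_zero]

end

/-- The operad of a quadratic presentation is generated by its generators. -/
theorem mem_of_closed (R : QuadRel k E₁ E₂) (N : ∀ n, Submodule k (R.operad.obj n))
    (hone : R.operad.one ∈ N 1) (hun : ∀ e, R.genUn e ∈ N 1) (hbin : ∀ e, R.genBin e ∈ N 2)
    (hcomp : ∀ {m n r : ℕ} (a b : ℕ) (h : m = a + 1 + b) (h' : r = a + n + b) (x : R.operad.obj m)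
      (y : R.operad.obj n), x ∈ N m → y ∈ N n → R.operad.comp a b h h' x y ∈ N r)
    (n : ℕ) (x : R.operad.obj n) : x ∈ N n := by
  -- By linearity single trees suffice, and each is an iterated composite of corollas: a unary
  -- vertex over `t` is the corolla composed with `t`, a binary one is its corolla with `t`, then
  -- `s`, plugged in.
  have key : ∀ (t : PTree E₁ E₂) (n : ℕ) (h : t.leaves = n),
      R.projHom.map n ((treeOperad k E₁ E₂).proj _ n
        (Finsupp.single (⟨t, h⟩ : PTree.OfArity E₁ E₂ n) (1 : k))) ∈ N n := by
    intro t
    induction t with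
    | leaf => intro n h; cases h; exact hone
    | un e t ih =>
      intro n h
      have hx := hcomp (m := 1) (n := n) (r := n) 0 0 rfl (by omega) _ _ (hun e) (ih n h)
      convert hx using 1
      change _ = R.projHom.map n ((treeOperad k E₁ E₂).proj _ n
        ((treeOperad k E₁ E₂).comp (n := n) (r := n) 0 0 rfl (by omega) (corollaUn k E₂ e) _))
      congr 2
      simp only [corollaUn]
      rw [treeComp_single, one_mul]
      rfl
    | bin e s t ihs iht =>
      intro n h
      have hn : s.leaves + t.leaves = n := h
      have hx := hcomp (n := s.leaves) 0 t.leaves (by omega) (r := n) (by omega) _ _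
        (hcomp (n := t.leaves) 1 0 rfl (r := 1 + t.leaves) (by omega) _ _ (hbin e) (iht _ rfl))
        (ihs _ rfl)
      convert hx using 1
      change _ = R.projHom.map n ((treeOperad k E₁ E₂).proj _ n
        ((treeOperad k E₁ E₂).comp (n := s.leaves) 0 t.leaves (by omega) (by omega)
          ((treeOperad k E₁ E₂).comp (n := t.leaves) (r := 1 + t.leaves) 1 0 rfl (by omega)
            (corollaBin k E₁ e) _) _))
      congr 2
      simp only [corollaBin]
      rw [treeComp_single, treeComp_single, one_mul, one_mul]
      congr 1
  obtain ⟨x, rfl⟩ := Submodule.mkQ_surjective _ x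
  obtain ⟨x, rfl⟩ := Submodule.mkQ_surjective _ x
  induction x using Finsupp.induction_linear with
  | zero => rw [map_zero, map_zero]; exact zero_mem _
  | add x y hx hy => rw [map_add, map_add]; exact add_mem hx hy
  | single t c =>
    rw [← mul_one c, ← smul_eq_mul, ← Finsupp.smul_single]
    exact Submodule.smul_mem _ c (key t.1 n t.2)

/-- The locus where two morphisms agree is closed under composition and contains the identity and
the generators. -/
theorem hom_ext (R : QuadRel k E₁ E₂) (Φ Ψ : NSOperad.Hom R.operad P)
    (hun : ∀ e, Φ.map 1 (R.genUn e) = Ψ.map 1 (R.genUn e))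
    (hbin : ∀ e, Φ.map 2 (R.genBin e) = Ψ.map 2 (R.genBin e)) (n : ℕ) (x : R.operad.obj n) :
    Φ.map n x = Ψ.map n x := by
  refine R.mem_of_closed (fun n => LinearMap.eqLocus (Φ.map n) (Ψ.map n)) ?_ hun hbin ?_ n x
  · exact Φ.map_one.trans Ψ.map_one.symm
  · intro m n r a b h h' x y hx hy
    rw [LinearMap.mem_eqLocus] at hx hy ⊢
    rw [Φ.map_comp, Ψ.map_comp, hx, hy]

end QuadRel

end Universal

/-! ## Operads truncated in weight two -/

section Trunc

variable {k : Type u} [Field k] {F : Type w₁} {M : Type w₂}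
  [AddCommGroup F] [Module k F] [AddCommGroup M] [Module k M]

variable (k F M) in
/-- The arity `n` part of a truncated operad: a scalar (zero unless `n = 1`), a weight one part and
a weight two part. -/
def truncObj (n : ℕ) : Submodule k (k × F × M) where
  carrier := {x | n ≠ 1 → x.1 = 0}
  add_mem' hx hy h := by simp [hx h, hy h]
  zero_mem' _ := rfl
  smul_mem' c x hx h := by simp [hx h]

/-- Composition in a truncated operad. -/
def truncComp (B : F →ₗ[k] F →ₗ[k] M) {m n r a b : ℕ} (h : m = a + 1 + b) (h' : r = a + n + b) :
    truncObj k F M m →ₗ[k] truncObj k F M n →ₗ[k] truncObj k F M r :=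
  LinearMap.mk₂ k
    (fun x y => ⟨(x.1.1 * y.1.1, x.1.1 • y.1.2.1 + y.1.1 • x.1.2.1,
      x.1.1 • y.1.2.2 + y.1.1 • x.1.2.2 + B x.1.2.1 y.1.2.1), fun hr => by
        by_cases hm : m = 1
        · rw [y.2 (by omega), mul_zero]
        · rw [x.2 hm, zero_mul]⟩)
    (fun x x' y => Subtype.ext (Prod.ext (add_mul _ _ _) (Prod.ext
      (by simp [add_smul]; abel) (by simp [add_smul]; abel))))
    (fun c x y => Subtype.ext (Prod.ext (mul_assoc _ _ _) (Prod.ext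
      (by simp [mul_smul, smul_comm c]) (by simp [mul_smul, smul_comm c]))))
    (fun x y y' => Subtype.ext (Prod.ext (mul_add _ _ _) (Prod.ext
      (by simp [add_smul]; abel) (by simp [add_smul]; abel))))
    (fun c x y => Subtype.ext (Prod.ext (mul_left_comm _ _ _) (Prod.ext
      (by simp [mul_smul, smul_comm c]) (by simp [mul_smul, smul_comm c]))))

theorem truncComp_val (B : F →ₗ[k] F →ₗ[k] M) {m n r a b : ℕ} (h : m = a + 1 + b)
    (h' : r = a + n + b) (x : truncObj k F M m) (y : truncObj k F M n) :
    (truncComp B h h' x y).1 = (x.1.1 * y.1.1, x.1.1 • y.1.2.1 + y.1.1 • x.1.2.1,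
      x.1.1 • y.1.2.2 + y.1.1 • x.1.2.2 + B x.1.2.1 y.1.2.1) := rfl

/-- The operad with given weight one part `F`, given weight two part `M`, and given compositions
of weight one elements. -/
def truncOperad (B : ℕ → ℕ → F →ₗ[k] F →ₗ[k] M) : NSOperad k where
  obj n := truncObj k F M n
  addCommGroup _ := inferInstance
  module _ := inferInstance
  one := ⟨(1, 0, 0), fun h => absurd rfl h⟩
  comp a b h h' := truncComp (B a b) h h'
  one_comp h h' x := Subtype.ext (by rw [truncComp_val]; simp)
  comp_one a b h h' x := Subtype.ext (by rw [truncComp_val]; simp)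
  comp_seq a b c d h₁ h₂ h₃ h₄ h₅ h₆ h₇ x y z := Subtype.ext (by
    -- The two bracketings use `B` at different positions, but only in terms carrying the scalar
    -- part of `x` or of `y`. Such a scalar vanishes unless the arity is one, and then the positions
    -- coincide.
    have hx : x.1.1 • B (a + c) (d + b) y.1.2.1 z.1.2.1 = x.1.1 • B c d y.1.2.1 z.1.2.1 := by
      by_cases hl : a = 0 ∧ b = 0
      · rw [hl.1, hl.2, zero_add, add_zero]
      · rw [x.2 (by omega), zero_smul, zero_smul]
    have hy : y.1.1 • B (a + c) (d + b) x.1.2.1 z.1.2.1 = y.1.1 • B a b x.1.2.1 z.1.2.1 := by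
      by_cases hl : c = 0 ∧ d = 0
      · rw [hl.1, hl.2, zero_add, add_zero]
      · rw [y.2 (by omega), zero_smul, zero_smul]
    simp only [truncComp_val, map_add, map_smul, LinearMap.add_apply, LinearMap.smul_apply,
      Prod.mk.injEq]
    rw [hx, hy]
    refine ⟨mul_assoc _ _ _, ?_, ?_⟩ <;> module)
  comp_par a b c h₁ h₂ h₃ h₄ h₅ h₆ h₇ h₈ x y z := Subtype.ext (by
    -- Two distinct inputs force the arity of `x` to be at least two, so `x` has no scalar part. As
    -- in sequential composition, the scalars of `y` and `z` count only where the positions agree.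
    have hx : x.1.1 = 0 := x.2 (by omega)
    rename_i l m n p q r
    have hy : y.1.1 • B (a + m + b) c x.1.2.1 z.1.2.1
        = y.1.1 • B (a + 1 + b) c x.1.2.1 z.1.2.1 := by
      by_cases hm : m = 1
      · subst hm; rfl
      · rw [y.2 hm, zero_smul, zero_smul]
    have hz : z.1.1 • B a (b + n + c) x.1.2.1 y.1.2.1
        = z.1.1 • B a (b + 1 + c) x.1.2.1 y.1.2.1 := by
      by_cases hn : n = 1
      · subst hn; rfl
      · rw [z.2 hn, zero_smul, zero_smul]
    simp only [truncComp_val, map_smul, LinearMap.smul_apply, Prod.mk.injEq, hx, hy, hz,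
      zero_smul, zero_mul, zero_add]
    refine ⟨trivial, ?_, ?_⟩ <;> module)

/-- The scalar part of an element of a truncated operad. -/
def truncScalar (B : ℕ → ℕ → F →ₗ[k] F →ₗ[k] M) (n : ℕ) : (truncOperad B).obj n →ₗ[k] k :=
  LinearMap.fst k k (F × M) ∘ₗ (truncObj k F M n).subtype

/-- The weight one part of an element of a truncated operad. -/
def truncLin (B : ℕ → ℕ → F →ₗ[k] F →ₗ[k] M) (n : ℕ) : (truncOperad B).obj n →ₗ[k] F :=
  LinearMap.fst k F M ∘ₗ LinearMap.snd k k (F × M) ∘ₗ (truncObj k F M n).subtype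

/-- The weight two part of an element of a truncated operad. -/
def truncQuad (B : ℕ → ℕ → F →ₗ[k] F →ₗ[k] M) (n : ℕ) : (truncOperad B).obj n →ₗ[k] M :=
  LinearMap.snd k F M ∘ₗ LinearMap.snd k k (F × M) ∘ₗ (truncObj k F M n).subtype

/-- The inclusion of the weight one part of a truncated operad. -/
def truncIncl (B : ℕ → ℕ → F →ₗ[k] F →ₗ[k] M) (n : ℕ) : F →ₗ[k] (truncOperad B).obj n :=
  (LinearMap.inr k k (F × M) ∘ₗ LinearMap.inl k F M).codRestrict (truncObj k F M n)
    (fun _ _ => rfl)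

variable (B : ℕ → ℕ → F →ₗ[k] F →ₗ[k] M)

theorem truncOperad_ext {n : ℕ} {x y : (truncOperad B).obj n}
    (h₀ : truncScalar B n x = truncScalar B n y) (h₁ : truncLin B n x = truncLin B n y)
    (h₂ : truncQuad B n x = truncQuad B n y) : x = y :=
  Subtype.ext (Prod.ext h₀ (Prod.ext h₁ h₂))

theorem truncScalar_eq_zero {n : ℕ} (hn : n ≠ 1) (x : (truncOperad B).obj n) :
    truncScalar B n x = 0 := x.2 hn

theorem truncLin_incl (n : ℕ) (u : F) : truncLin B n (truncIncl B n u) = u := rfl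

theorem truncLin_one : truncLin B 1 (truncOperad B).one = 0 := rfl

section

variable {m n r : ℕ} (a b : ℕ) (h : m = a + 1 + b) (h' : r = a + n + b)
    (x : (truncOperad B).obj m) (y : (truncOperad B).obj n)

theorem truncScalar_comp : truncScalar B r ((truncOperad B).comp a b h h' x y)
    = truncScalar B m x * truncScalar B n y := rfl

theorem truncLin_comp : truncLin B r ((truncOperad B).comp a b h h' x y)
    = truncScalar B m x • truncLin B n y + truncScalar B n y • truncLin B m x := rfl

theorem truncQuad_comp : truncQuad B r ((truncOperad B).comp a b h h' x y)
    = truncScalar B m x • truncQuad B n y + truncScalar B n y • truncQuad B m x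
      + B a b (truncLin B m x) (truncLin B n y) := rfl

end

end Trunc

/-! ## Maps of quadratic presentations -/

namespace QuadRel

variable {k : Type u} [Field k] {E₁ : Type v₁} {E₂ : Type v₂} {F₁ : Type w₁} {F₂ : Type w₂}
  [AddCommGroup E₁] [Module k E₁] [AddCommGroup E₂] [Module k E₂]
  [AddCommGroup F₁] [Module k F₁] [AddCommGroup F₂] [Module k F₂]

/-- The map induced on weight two elements of arity two. -/
noncomputable def quadMap₂ (f : E₁ →ₗ[k] F₁) (g : E₂ →ₗ[k] F₂) :
    (E₁ ⊗[k] E₂) × (E₂ ⊗[k] E₁) × (E₂ ⊗[k] E₁) →ₗ[k]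
      (F₁ ⊗[k] F₂) × (F₂ ⊗[k] F₁) × (F₂ ⊗[k] F₁) :=
  (TensorProduct.map f g).prodMap ((TensorProduct.map g f).prodMap (TensorProduct.map g f))

/-- The map induced on weight two elements of arity three. -/
noncomputable def quadMap₃ (g : E₂ →ₗ[k] F₂) :
    (E₂ ⊗[k] E₂) × (E₂ ⊗[k] E₂) →ₗ[k] (F₂ ⊗[k] F₂) × (F₂ ⊗[k] F₂) :=
  (TensorProduct.map g g).prodMap (TensorProduct.map g g)

/-- Linear maps between generators that send relations to relations. -/
structure Compat (R : QuadRel k E₁ E₂) (S : QuadRel k F₁ F₂) (f : E₁ →ₗ[k] F₁)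
    (g : E₂ →ₗ[k] F₂) : Prop where
  le₁ : R.R₁ ≤ S.R₁.comap (TensorProduct.map f f)
  le₂ : R.R₂ ≤ S.R₂.comap (quadMap₂ f g)
  le₃ : R.R₃ ≤ S.R₃.comap (quadMap₃ g)

section Eval

variable {P : NSOperad.{u, w} k}

theorem quadEval₁_comp (f' : F₁ →ₗ[k] P.obj 1) (f : E₁ →ₗ[k] F₁) :
    quadEval₁ P (f' ∘ₗ f) = quadEval₁ P f' ∘ₗ TensorProduct.map f f := by
  ext x y; rfl

theorem quadEval₂_comp (f' : F₁ →ₗ[k] P.obj 1) (g' : F₂ →ₗ[k] P.obj 2) (f : E₁ →ₗ[k] F₁)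
    (g : E₂ →ₗ[k] F₂) :
    quadEval₂ P (f' ∘ₗ f) (g' ∘ₗ g) = quadEval₂ P f' g' ∘ₗ quadMap₂ f g := by
  ext x y <;> simp [quadEval₂, quadMap₂]

theorem quadEval₃_comp (g' : F₂ →ₗ[k] P.obj 2) (g : E₂ →ₗ[k] F₂) :
    quadEval₃ P (g' ∘ₗ g) = quadEval₃ P g' ∘ₗ quadMap₃ g := by
  ext x y <;> simp [quadEval₃, quadMap₃]

end Eval

namespace Compat

variable {R : QuadRel k E₁ E₂} {S : QuadRel k F₁ F₂} {f : E₁ →ₗ[k] F₁} {g : E₂ →ₗ[k] F₂}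

/-- The morphism of operads induced by a map of presentations. -/
noncomputable def toHom (h : Compat R S f g) : NSOperad.Hom R.operad S.operad :=
  R.lift (S.genUn ∘ₗ f) (S.genBin ∘ₗ g)
    (fun r hr => by
      rw [quadEval₁_comp]; exact S.hom_rel₁ (NSOperad.Hom.id _) (h.le₁ hr))
    (fun r hr => by
      rw [quadEval₂_comp]; exact S.hom_rel₂ (NSOperad.Hom.id _) (h.le₂ hr))
    (fun r hr => by
      rw [quadEval₃_comp]; exact S.hom_rel₃ (NSOperad.Hom.id _) (h.le₃ hr))

theorem toHom_genUn (h : Compat R S f g) (e : E₁) : h.toHom.map 1 (R.genUn e) = S.genUn (f e) :=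
  lift_genUn _ _ _ _ _ _ _

theorem toHom_genBin (h : Compat R S f g) (e : E₂) :
    h.toHom.map 2 (R.genBin e) = S.genBin (g e) :=
  lift_genBin _ _ _ _ _ _ _

end Compat

/-- The isomorphism of operads induced by an isomorphism of presentations. -/
noncomputable def isoOfCompat {R : QuadRel k E₁ E₂} {S : QuadRel k F₁ F₂} (f : E₁ ≃ₗ[k] F₁)
    (g : E₂ ≃ₗ[k] F₂) (h : Compat R S f.toLinearMap g.toLinearMap)
    (h' : Compat S R f.symm.toLinearMap g.symm.toLinearMap) :
    NSOperad.Iso R.operad S.operad :=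
  NSOperad.Iso.ofHom h.toHom h'.toHom
    (R.hom_ext (h'.toHom.comp h.toHom) (NSOperad.Hom.id _)
      (fun e => by
        change h'.toHom.map 1 (h.toHom.map 1 _) = R.genUn e
        rw [h.toHom_genUn, h'.toHom_genUn]; simp)
      (fun e => by
        change h'.toHom.map 2 (h.toHom.map 2 _) = R.genBin e
        rw [h.toHom_genBin, h'.toHom_genBin]; simp))
    (S.hom_ext (h.toHom.comp h'.toHom) (NSOperad.Hom.id _)
      (fun e => by
        change h.toHom.map 1 (h'.toHom.map 1 _) = S.genUn e
        rw [h'.toHom_genUn, h.toHom_genUn]; simp)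
      (fun e => by
        change h.toHom.map 2 (h'.toHom.map 2 _) = S.genBin e
        rw [h'.toHom_genBin, h.toHom_genBin]; simp))

/-- Replication is natural: applying `f` and `g` copy by copy commutes with placing indices, so each
replica of a relation of `R` goes to a replica of a relation of `S`. -/
theorem Compat.mat {R : QuadRel k E₁ E₂} {S : QuadRel k F₁ F₂} {f : E₁ →ₗ[k] F₁} {g : E₂ →ₗ[k] F₂}
    (h : Compat R S f g) (Ω : Type w) :
    Compat (R.mat Ω) (S.mat Ω) (Finsupp.mapRange.linearMap f) (Finsupp.mapRange.linearMap g) where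
  le₁ := iSup₂_le fun μ ν => by
    rw [Submodule.map_le_iff_le_comap]
    intro r hr
    have H : TensorProduct.map (Finsupp.mapRange.linearMap f) (Finsupp.mapRange.linearMap f)
        ∘ₗ rep₁ μ ν = rep₁ μ ν ∘ₗ TensorProduct.map f f := by
      ext x y; simp [rep₁]
    change (TensorProduct.map (Finsupp.mapRange.linearMap f) (Finsupp.mapRange.linearMap f)
      ∘ₗ rep₁ μ ν) r ∈ (S.mat Ω).R₁
    rw [H]
    exact le_iSup₂ (f := fun μ ν => S.R₁.map (rep₁ μ ν)) μ ν (Submodule.mem_map_of_mem (h.le₁ hr))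
  le₂ := iSup₂_le fun μ ν => by
    rw [Submodule.map_le_iff_le_comap]
    intro r hr
    have H : quadMap₂ (Finsupp.mapRange.linearMap f) (Finsupp.mapRange.linearMap g)
        ∘ₗ rep₂ μ ν = rep₂ μ ν ∘ₗ quadMap₂ f g := by
      ext x y <;> simp [rep₂, quadMap₂]
    change (quadMap₂ (Finsupp.mapRange.linearMap f) (Finsupp.mapRange.linearMap g)
      ∘ₗ rep₂ μ ν) r ∈ (S.mat Ω).R₂
    rw [H]
    exact le_iSup₂ (f := fun μ ν => S.R₂.map (rep₂ μ ν)) μ ν (Submodule.mem_map_of_mem (h.le₂ hr))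
  le₃ := iSup₂_le fun μ ν => by
    rw [Submodule.map_le_iff_le_comap]
    intro r hr
    have H : quadMap₃ (Finsupp.mapRange.linearMap g)
        ∘ₗ rep₃ μ ν = rep₃ μ ν ∘ₗ quadMap₃ g := by
      ext x y <;> simp [rep₃, quadMap₃]
    change (quadMap₃ (Finsupp.mapRange.linearMap g)
      ∘ₗ rep₃ μ ν) r ∈ (S.mat Ω).R₃
    rw [H]
    exact le_iSup₂ (f := fun μ ν => S.R₃.map (rep₃ μ ν)) μ ν (Submodule.mem_map_of_mem (h.le₃ hr))

/-! ## The linear part of an isomorphism -/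

section Trunc

variable {F : Type w₁} {M : Type w₂} [AddCommGroup F] [Module k F] [AddCommGroup M] [Module k M]
  (B : ℕ → ℕ → F →ₗ[k] F →ₗ[k] M)

/-- Contraction of one of the two unary vertices, in arity one. -/
noncomputable def contract₁ (χ : E₁ →ₗ[k] k) : E₁ ⊗[k] E₁ →ₗ[k] E₁ :=
  (TensorProduct.lid k E₁).toLinearMap ∘ₗ χ.rTensor E₁
    + (TensorProduct.rid k E₁).toLinearMap ∘ₗ χ.lTensor E₁

/-- Contraction of the unary vertex, in arity two. -/
noncomputable def contract₂ (χ : E₁ →ₗ[k] k) :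
    (E₁ ⊗[k] E₂) × (E₂ ⊗[k] E₁) × (E₂ ⊗[k] E₁) →ₗ[k] E₂ :=
  ((TensorProduct.lid k E₂).toLinearMap ∘ₗ χ.rTensor E₂).coprod
    (((TensorProduct.rid k E₂).toLinearMap ∘ₗ χ.lTensor E₂).coprod
      ((TensorProduct.rid k E₂).toLinearMap ∘ₗ χ.lTensor E₂))

variable (f : E₁ →ₗ[k] (truncOperad B).obj 1) (g : E₂ →ₗ[k] (truncOperad B).obj 2)

/-- This lemma and the following ones expand by weight a composite of two elements of the form
scalar + linear + quadratic. A scalar times a linear or quadratic part produces the contractions;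
only linear times linear involves `B`. -/
theorem truncScalar_quadEval₁ :
    truncScalar B 1 ∘ₗ quadEval₁ (truncOperad B) f
      = LinearMap.mul' k k ∘ₗ
        TensorProduct.map (truncScalar B 1 ∘ₗ f) (truncScalar B 1 ∘ₗ f) := by
  ext x y
  exact truncScalar_comp B 0 0 rfl rfl (f x) (f y)

theorem truncLin_quadEval₁ :
    truncLin B 1 ∘ₗ quadEval₁ (truncOperad B) f
      = (truncLin B 1 ∘ₗ f) ∘ₗ contract₁ (truncScalar B 1 ∘ₗ f) := by
  ext x y
  refine (truncLin_comp B 0 0 rfl rfl (f x) (f y)).trans ?_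
  simp [contract₁]

theorem truncQuad_quadEval₁ :
    truncQuad B 1 ∘ₗ quadEval₁ (truncOperad B) f
      = (truncQuad B 1 ∘ₗ f) ∘ₗ contract₁ (truncScalar B 1 ∘ₗ f)
        + TensorProduct.lift (B 0 0) ∘ₗ
          TensorProduct.map (truncLin B 1 ∘ₗ f) (truncLin B 1 ∘ₗ f) := by
  ext x y
  refine (truncQuad_comp B 0 0 rfl rfl (f x) (f y)).trans ?_
  simp [contract₁]

theorem truncLin_quadEval₂ :
    truncLin B 2 ∘ₗ quadEval₂ (truncOperad B) f g
      = (truncLin B 2 ∘ₗ g) ∘ₗ contract₂ (truncScalar B 1 ∘ₗ f) := by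
  ext x y
  · refine Eq.trans ?_ ((truncLin_comp B 0 0 rfl rfl (f x) (g y)).trans ?_) <;>
      simp [contract₂, quadEval₂, truncScalar_eq_zero]
  · refine Eq.trans ?_ ((truncLin_comp B 0 1 rfl rfl (g x) (f y)).trans ?_) <;>
      simp [contract₂, quadEval₂, truncScalar_eq_zero]
  · refine Eq.trans ?_ ((truncLin_comp B 1 0 rfl rfl (g x) (f y)).trans ?_) <;>
      simp [contract₂, quadEval₂, truncScalar_eq_zero]

theorem truncQuad_quadEval₂ :
    truncQuad B 2 ∘ₗ quadEval₂ (truncOperad B) f g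
      = (truncQuad B 2 ∘ₗ g) ∘ₗ contract₂ (truncScalar B 1 ∘ₗ f)
        + (TensorProduct.lift (B 0 0)).coprod
            ((TensorProduct.lift (B 0 1)).coprod (TensorProduct.lift (B 1 0))) ∘ₗ
          quadMap₂ (truncLin B 1 ∘ₗ f) (truncLin B 2 ∘ₗ g) := by
  ext x y
  · refine Eq.trans ?_ ((truncQuad_comp B 0 0 rfl rfl (f x) (g y)).trans ?_) <;>
      simp [contract₂, quadMap₂, quadEval₂, truncScalar_eq_zero]
  · refine Eq.trans ?_ ((truncQuad_comp B 0 1 rfl rfl (g x) (f y)).trans ?_) <;>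
      simp [contract₂, quadMap₂, quadEval₂, truncScalar_eq_zero]
  · refine Eq.trans ?_ ((truncQuad_comp B 1 0 rfl rfl (g x) (f y)).trans ?_) <;>
      simp [contract₂, quadMap₂, quadEval₂, truncScalar_eq_zero]

/-- Elements of arity two have no scalar part, so a composite of two of them has nothing below
weight two. -/
theorem truncLin_quadEval₃ : truncLin B 3 ∘ₗ quadEval₃ (truncOperad B) g = 0 := by
  ext x y
  · refine Eq.trans ?_ ((truncLin_comp B 0 1 rfl rfl (g x) (g y)).trans ?_) <;>
      simp [quadEval₃, truncScalar_eq_zero]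
  · refine Eq.trans ?_ ((truncLin_comp B 1 0 rfl rfl (g x) (g y)).trans ?_) <;>
      simp [quadEval₃, truncScalar_eq_zero]

theorem truncQuad_quadEval₃ :
    truncQuad B 3 ∘ₗ quadEval₃ (truncOperad B) g
      = (TensorProduct.lift (B 0 1)).coprod (TensorProduct.lift (B 1 0)) ∘ₗ
          quadMap₃ (truncLin B 2 ∘ₗ g) := by
  ext x y
  · refine Eq.trans ?_ ((truncQuad_comp B 0 1 rfl rfl (g x) (g y)).trans ?_) <;>
      simp [quadMap₃, quadEval₃, truncScalar_eq_zero]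
  · refine Eq.trans ?_ ((truncQuad_comp B 1 0 rfl rfl (g x) (g y)).trans ?_) <;>
      simp [quadMap₃, quadEval₃, truncScalar_eq_zero]

/-- The weight one parts of the values of a morphism are controlled by those of the generators. -/
theorem truncLin_mem (R : QuadRel k E₁ E₂) (Ψ : NSOperad.Hom R.operad (truncOperad B))
    (L : ℕ → Submodule k F) (h₁ : ∀ e, truncLin B 1 (Ψ.map 1 (R.genUn e)) ∈ L 1)
    (h₂ : ∀ e, truncLin B 2 (Ψ.map 2 (R.genBin e)) ∈ L 2) (n : ℕ) (x : R.operad.obj n) :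
    truncLin B n (Ψ.map n x) ∈ L n := by
  refine R.mem_of_closed (fun n => (L n).comap (truncLin B n ∘ₗ Ψ.map n)) ?_ h₁ h₂ ?_ n x
  · change truncLin B 1 (Ψ.map 1 _) ∈ L 1
    rw [Ψ.map_one, truncLin_one]
    exact zero_mem _
  · intro m n r a b h h' x y hx hy
    change truncLin B r (Ψ.map r _) ∈ L r
    rw [Ψ.map_comp, truncLin_comp]
    refine add_mem ?_ ?_
    -- The linear part of `y` survives only next to a nonzero scalar part of `x`; this needs `m =
    -- 1`, so that `r = n` and the target subspace is unchanged.
    · by_cases hm : m = 1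
      · obtain rfl : r = n := by omega
        exact Submodule.smul_mem _ _ hy
      · rw [truncScalar_eq_zero B hm, zero_smul]
        exact zero_mem _
    · by_cases hn : n = 1
      · obtain rfl : r = m := by omega
        exact Submodule.smul_mem _ _ hx
      · rw [truncScalar_eq_zero B hn, zero_smul]
        exact zero_mem _

end Trunc

/-! ### The weight two truncation of a presented operad -/

section Truncation

variable (S : QuadRel k F₁ F₂)

/-- The weight two part of the operad of a quadratic presentation. -/
abbrev WeightTwo : Type _ :=
  ((F₁ ⊗[k] F₁) ⧸ S.R₁) × (((F₁ ⊗[k] F₂) × (F₂ ⊗[k] F₁) × (F₂ ⊗[k] F₁)) ⧸ S.R₂) ×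
    (((F₂ ⊗[k] F₂) × (F₂ ⊗[k] F₂)) ⧸ S.R₃)

/-- The compositions of generators, as elements of the weight two part. -/
noncomputable def weightTwoTensor :
    ℕ → ℕ → (F₁ × F₂) ⊗[k] (F₁ × F₂) →ₗ[k] S.WeightTwo
  | 0, 0 => LinearMap.prod
      (S.R₁.mkQ ∘ₗ TensorProduct.map (.fst k F₁ F₂) (.fst k F₁ F₂))
      (LinearMap.prod
        (S.R₂.mkQ ∘ₗ .prod (TensorProduct.map (.fst k F₁ F₂) (.snd k F₁ F₂)) 0) 0)
  | 0, 1 => LinearMap.prod 0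
      (LinearMap.prod
        (S.R₂.mkQ ∘ₗ .prod 0 (.prod (TensorProduct.map (.snd k F₁ F₂) (.fst k F₁ F₂)) 0))
        (S.R₃.mkQ ∘ₗ .prod (TensorProduct.map (.snd k F₁ F₂) (.snd k F₁ F₂)) 0))
  | 1, 0 => LinearMap.prod 0
      (LinearMap.prod
        (S.R₂.mkQ ∘ₗ .prod 0 (.prod 0 (TensorProduct.map (.snd k F₁ F₂) (.fst k F₁ F₂))))
        (S.R₃.mkQ ∘ₗ .prod 0 (TensorProduct.map (.snd k F₁ F₂) (.snd k F₁ F₂))))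
  | _, _ => 0

/-- The composition of two generators. -/
noncomputable def weightTwoComp (a b : ℕ) :
    F₁ × F₂ →ₗ[k] F₁ × F₂ →ₗ[k] S.WeightTwo :=
  (TensorProduct.mk k (F₁ × F₂) (F₁ × F₂)).compr₂ (S.weightTwoTensor a b)

theorem lift_weightTwoComp (a b : ℕ) :
    TensorProduct.lift (S.weightTwoComp a b) = S.weightTwoTensor a b := by
  ext x y <;> rfl

/-- Position (0, 0) is the input of a unary root, (0, 1) and (1, 0) are the two inputs of a binary
one. Once the inputs are homogeneous in arity, a single factor of `WeightTwo` is hit, through the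
class modulo the relations; likewise in arities two and three. -/
theorem weightTwo_arity₁ (f : E₁ →ₗ[k] F₁) :
    TensorProduct.lift (S.weightTwoComp 0 0) ∘ₗ
        TensorProduct.map (.inl k F₁ F₂ ∘ₗ f) (.inl k F₁ F₂ ∘ₗ f)
      = .inl k _ _ ∘ₗ S.R₁.mkQ ∘ₗ TensorProduct.map f f := by
  rw [lift_weightTwoComp]
  ext x y <;> simp [Prod.mk_zero_zero, weightTwoTensor]

theorem weightTwo_arity₂ (f : E₁ →ₗ[k] F₁) (g : E₂ →ₗ[k] F₂) :
    (TensorProduct.lift (S.weightTwoComp 0 0)).coprod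
        ((TensorProduct.lift (S.weightTwoComp 0 1)).coprod
          (TensorProduct.lift (S.weightTwoComp 1 0))) ∘ₗ
        quadMap₂ (.inl k F₁ F₂ ∘ₗ f) (.inr k F₁ F₂ ∘ₗ g)
      = .inr k _ _ ∘ₗ .inl k _ _ ∘ₗ S.R₂.mkQ ∘ₗ quadMap₂ f g := by
  simp only [lift_weightTwoComp]
  ext x y <;> simp [Prod.mk_zero_zero, weightTwoTensor, quadMap₂]

theorem weightTwo_arity₃ (g : E₂ →ₗ[k] F₂) :
    (TensorProduct.lift (S.weightTwoComp 0 1)).coprod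
        (TensorProduct.lift (S.weightTwoComp 1 0)) ∘ₗ
        quadMap₃ (.inr k F₁ F₂ ∘ₗ g)
      = .inr k _ _ ∘ₗ .inr k _ _ ∘ₗ S.R₃.mkQ ∘ₗ quadMap₃ g := by
  simp only [lift_weightTwoComp]
  ext x y <;> simp [Prod.mk_zero_zero, weightTwoTensor, quadMap₃]

/-- The truncation in weight two of the operad of a quadratic presentation. -/
noncomputable abbrev truncation : NSOperad k := truncOperad S.weightTwoComp

end Truncation

theorem contract₁_zero : contract₁ (0 : E₁ →ₗ[k] k) = 0 := by
  ext x y; simp [contract₁]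

theorem contract₂_zero : contract₂ (E₂ := E₂) (0 : E₁ →ₗ[k] k) = 0 := by
  ext x y <;> simp [contract₂]

theorem quadMap₂_id : quadMap₂ (.id : E₁ →ₗ[k] E₁) (.id : E₂ →ₗ[k] E₂) = .id := by
  ext x y <;> simp [quadMap₂]

theorem quadMap₃_id : quadMap₃ (.id : E₂ →ₗ[k] E₂) = .id := by
  ext x y <;> simp [quadMap₃]

/-- The projection of the operad of a quadratic presentation to its truncation. -/
noncomputable def toTruncation (S : QuadRel k F₁ F₂) : NSOperad.Hom S.operad S.truncation :=
  S.lift (P := S.truncation) (truncIncl _ 1 ∘ₗ .inl k F₁ F₂) (truncIncl _ 2 ∘ₗ .inr k F₁ F₂)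
    (fun r hr => by
      -- Generators are sent to purely linear elements, so all contractions vanish and only the
      -- class of `r` modulo `S.R₁` is left, which is zero.
      have hs : truncScalar S.weightTwoComp 1 ∘ₗ truncIncl _ 1 ∘ₗ .inl k F₁ F₂ = 0 := rfl
      have hl : truncLin S.weightTwoComp 1 ∘ₗ truncIncl _ 1 ∘ₗ .inl k F₁ F₂ = .inl k F₁ F₂ := rfl
      have H₀ := LinearMap.congr_fun
        (truncScalar_quadEval₁ S.weightTwoComp (truncIncl _ 1 ∘ₗ .inl k F₁ F₂)) r
      have H₁ := LinearMap.congr_fun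
        (truncLin_quadEval₁ S.weightTwoComp (truncIncl _ 1 ∘ₗ .inl k F₁ F₂)) r
      have H₂ := LinearMap.congr_fun
        (truncQuad_quadEval₁ S.weightTwoComp (truncIncl _ 1 ∘ₗ .inl k F₁ F₂)) r
      have H := LinearMap.congr_fun (S.weightTwo_arity₁ (.id : F₁ →ₗ[k] F₁)) r
      rw [LinearMap.comp_id, TensorProduct.map_id] at H
      rw [hs, hl, contract₁_zero, LinearMap.comp_zero, zero_add, H] at H₂
      rw [hs, contract₁_zero] at H₁
      rw [hs] at H₀
      refine truncOperad_ext _ (H₀.trans ?_) (H₁.trans ?_) (H₂.trans ?_)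
      · simp
      · simp
      · simp [(Submodule.Quotient.mk_eq_zero S.R₁).2 hr])
    (fun r hr => by
      have hs : truncScalar S.weightTwoComp 1 ∘ₗ truncIncl _ 1 ∘ₗ .inl k F₁ F₂ = 0 := rfl
      have hl : truncLin S.weightTwoComp 1 ∘ₗ truncIncl _ 1 ∘ₗ .inl k F₁ F₂ = .inl k F₁ F₂ := rfl
      have hl' : truncLin S.weightTwoComp 2 ∘ₗ truncIncl _ 2 ∘ₗ .inr k F₁ F₂ = .inr k F₁ F₂ := rfl
      have H₁ := LinearMap.congr_fun
        (truncLin_quadEval₂ S.weightTwoComp (truncIncl _ 1 ∘ₗ .inl k F₁ F₂)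
          (truncIncl _ 2 ∘ₗ .inr k F₁ F₂)) r
      have H₂ := LinearMap.congr_fun
        (truncQuad_quadEval₂ S.weightTwoComp (truncIncl _ 1 ∘ₗ .inl k F₁ F₂)
          (truncIncl _ 2 ∘ₗ .inr k F₁ F₂)) r
      have H := LinearMap.congr_fun (S.weightTwo_arity₂ (.id : F₁ →ₗ[k] F₁) (.id : F₂ →ₗ[k] F₂)) r
      rw [LinearMap.comp_id, LinearMap.comp_id, quadMap₂_id] at H
      rw [hs, hl, hl', contract₂_zero, LinearMap.comp_zero, zero_add, H] at H₂
      rw [hs, contract₂_zero] at H₁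
      refine truncOperad_ext _ (truncScalar_eq_zero _ (by decide) _) (H₁.trans ?_) (H₂.trans ?_)
      · simp
      · simp [(Submodule.Quotient.mk_eq_zero S.R₂).2 hr])
    (fun r hr => by
      have hl : truncLin S.weightTwoComp 2 ∘ₗ truncIncl _ 2 ∘ₗ .inr k F₁ F₂ = .inr k F₁ F₂ := rfl
      have H₁ := LinearMap.congr_fun
        (truncLin_quadEval₃ S.weightTwoComp (truncIncl _ 2 ∘ₗ .inr k F₁ F₂)) r
      have H₂ := LinearMap.congr_fun
        (truncQuad_quadEval₃ S.weightTwoComp (truncIncl _ 2 ∘ₗ .inr k F₁ F₂)) r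
      have H := LinearMap.congr_fun (S.weightTwo_arity₃ (.id : F₂ →ₗ[k] F₂)) r
      rw [LinearMap.comp_id, quadMap₃_id] at H
      rw [hl, H] at H₂
      refine truncOperad_ext _ (truncScalar_eq_zero _ (by decide) _) (H₁.trans ?_) (H₂.trans ?_)
      · simp
      · simp [(Submodule.Quotient.mk_eq_zero S.R₃).2 hr])

theorem toTruncation_genUn (S : QuadRel k F₁ F₂) (e : F₁) :
    S.toTruncation.map 1 (S.genUn e) = truncIncl S.weightTwoComp 1 (e, 0) :=
  lift_genUn _ _ _ _ _ _ _

theorem toTruncation_genBin (S : QuadRel k F₁ F₂) (e : F₂) :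
    S.toTruncation.map 2 (S.genBin e) = truncIncl S.weightTwoComp 2 (0, e) :=
  lift_genBin _ _ _ _ _ _ _

/-- The truncated operad allows the whole of `F₁ × F₂` in every arity. On the image of the presented
operad the linear part lies in `F₁` in arity one, in `F₂` in arity two, and is zero otherwise. -/
theorem toTruncation_lin_mem (S : QuadRel k F₁ F₂) (n : ℕ) (x : S.operad.obj n) :
    truncLin S.weightTwoComp n (S.toTruncation.map n x)
      ∈ (⨆ _ : n = 1, (⊤ : Submodule k F₁)).prod (⨆ _ : n = 2, (⊤ : Submodule k F₂)) := by
  refine truncLin_mem _ S S.toTruncation (fun n =>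
    (⨆ _ : n = 1, (⊤ : Submodule k F₁)).prod (⨆ _ : n = 2, (⊤ : Submodule k F₂))) ?_ ?_ n x
  · intro e
    rw [toTruncation_genUn, truncLin_incl]
    simp
  · intro e
    rw [toTruncation_genBin, truncLin_incl]
    simp

/-- A surjective morphism between operads of quadratic presentations with as many generators
has a linear part, which is a map of presentations. -/
theorem exists_linear_part [FiniteDimensional k E₁] [FiniteDimensional k E₂]
    [FiniteDimensional k F₁] [FiniteDimensional k F₂]
    (h₁ : Module.finrank k E₁ = Module.finrank k F₁)
    (h₂ : Module.finrank k E₂ = Module.finrank k F₂)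
    {R : QuadRel k E₁ E₂} {S : QuadRel k F₁ F₂} (φ : NSOperad.Hom R.operad S.operad)
    (hφ : ∀ n, Function.Surjective (φ.map n)) :
    ∃ (f : E₁ ≃ₗ[k] F₁) (g : E₂ ≃ₗ[k] F₂), Compat R S f.toLinearMap g.toLinearMap := by
  -- Modulo weight three, `φ` sends a unary generator to `χ` times the identity plus the linear part
  -- `l₁` plus a quadratic part; a binary generator has no scalar part.
  set Ψ : NSOperad.Hom R.operad S.truncation := S.toTruncation.comp φ with hΨ
  set χ := truncScalar S.weightTwoComp 1 ∘ₗ Ψ.map 1 ∘ₗ R.genUn with hχ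
  set l₁ := truncLin S.weightTwoComp 1 ∘ₗ Ψ.map 1 ∘ₗ R.genUn with hl₁
  set l₂ := truncLin S.weightTwoComp 2 ∘ₗ Ψ.map 2 ∘ₗ R.genBin with hl₂
  set f : E₁ →ₗ[k] F₁ := .fst k F₁ F₂ ∘ₗ l₁ with hf
  set g : E₂ →ₗ[k] F₂ := .snd k F₁ F₂ ∘ₗ l₂ with hg
  have hlf : l₁ = .inl k F₁ F₂ ∘ₗ f := by
    refine LinearMap.ext fun e => Prod.ext rfl ?_
    have := (S.toTruncation_lin_mem 1 (φ.map 1 (R.genUn e))).2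
    simp only [OfNat.one_ne_ofNat, iSup_false] at this
    exact this
  have hlg : l₂ = .inr k F₁ F₂ ∘ₗ g := by
    refine LinearMap.ext fun e => Prod.ext ?_ rfl
    have := (S.toTruncation_lin_mem 2 (φ.map 2 (R.genBin e))).1
    simp only [OfNat.ofNat_ne_one, iSup_false] at this
    exact this
  -- Linear parts of arbitrary values stay in the span of those of the generators. Since a generator
  -- of `S` is its own linear part and `φ` is surjective, `f` and `g` are surjective.
  have hmem : ∀ n (x : R.operad.obj n),
      truncLin S.weightTwoComp n (Ψ.map n x) ∈ (LinearMap.range f).prod (LinearMap.range g) := by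
    refine truncLin_mem _ R Ψ (fun _ => (LinearMap.range f).prod (LinearMap.range g)) ?_ ?_
    · intro e
      change l₁ e ∈ _
      rw [hlf]
      exact ⟨⟨e, rfl⟩, zero_mem _⟩
    · intro e
      change l₂ e ∈ _
      rw [hlg]
      exact ⟨zero_mem _, ⟨e, rfl⟩⟩
  have hfs : Function.Surjective f := by
    intro e
    obtain ⟨x, hx⟩ := hφ 1 (S.genUn e)
    have := (hmem 1 x).1
    change (truncLin S.weightTwoComp 1 (S.toTruncation.map 1 (φ.map 1 x))).1 ∈ _ at this
    rwa [hx, toTruncation_genUn, truncLin_incl] at this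
  have hgs : Function.Surjective g := by
    intro e
    obtain ⟨x, hx⟩ := hφ 2 (S.genBin e)
    have := (hmem 2 x).2
    change (truncLin S.weightTwoComp 2 (S.toTruncation.map 2 (φ.map 2 x))).2 ∈ _ at this
    rwa [hx, toTruncation_genBin, truncLin_incl] at this
  have hfi : Function.Injective f :=
    (LinearMap.injective_iff_surjective_of_finrank_eq_finrank h₁).2 hfs
  have hgi : Function.Injective g :=
    (LinearMap.injective_iff_surjective_of_finrank_eq_finrank h₂).2 hgs
  have hl₁i : Function.Injective l₁ := by rw [hlf]; exact LinearMap.inl_injective.comp hfi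
  have hl₂i : Function.Injective l₂ := by rw [hlg]; exact LinearMap.inr_injective.comp hgi
  refine ⟨.ofBijective f ⟨hfi, hfs⟩, .ofBijective g ⟨hgi, hgs⟩, ?_, ?_, ?_⟩
  · intro r hr
    have h := R.hom_rel₁ Ψ hr
    have H₁ := LinearMap.congr_fun (truncLin_quadEval₁ S.weightTwoComp (Ψ.map 1 ∘ₗ R.genUn)) r
    have H₂ := LinearMap.congr_fun (truncQuad_quadEval₁ S.weightTwoComp (Ψ.map 1 ∘ₗ R.genUn)) r
    rw [LinearMap.comp_apply, h, map_zero, LinearMap.comp_apply] at H₁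
    -- The weight one part of the vanishing image of `r` is `l₁` of its contraction by `χ`. By
    -- injectivity the contraction is zero, which also removes the unknown quadratic parts from the
    -- weight two equation.
    have hc := hl₁i ((H₁.symm).trans (map_zero l₁).symm)
    rw [LinearMap.comp_apply, h, map_zero, LinearMap.add_apply, LinearMap.comp_apply, hc, map_zero,
      zero_add, ← hl₁, hlf, weightTwo_arity₁] at H₂
    exact Submodule.mem_comap.2
      ((Submodule.Quotient.mk_eq_zero S.R₁).1 (congrArg Prod.fst H₂).symm)
  · intro r hr
    have h := R.hom_rel₂ Ψ hr
    have H₁ := LinearMap.congr_fun (truncLin_quadEval₂ S.weightTwoComp (Ψ.map 1 ∘ₗ R.genUn)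
      (Ψ.map 2 ∘ₗ R.genBin)) r
    have H₂ := LinearMap.congr_fun (truncQuad_quadEval₂ S.weightTwoComp (Ψ.map 1 ∘ₗ R.genUn)
      (Ψ.map 2 ∘ₗ R.genBin)) r
    rw [LinearMap.comp_apply, h, map_zero, LinearMap.comp_apply] at H₁
    have hc := hl₂i ((H₁.symm).trans (map_zero l₂).symm)
    rw [LinearMap.comp_apply, h, map_zero, LinearMap.add_apply, LinearMap.comp_apply, hc, map_zero,
      zero_add, ← hl₁, ← hl₂, hlf, hlg, weightTwo_arity₂] at H₂
    exact Submodule.mem_comap.2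
      ((Submodule.Quotient.mk_eq_zero S.R₂).1 (congrArg (fun x => x.2.1) H₂).symm)
  · intro r hr
    have h := R.hom_rel₃ Ψ hr
    -- No contraction occurs in arity three, since neither factor has a scalar part.
    have H₂ := LinearMap.congr_fun (truncQuad_quadEval₃ S.weightTwoComp (Ψ.map 2 ∘ₗ R.genBin)) r
    rw [LinearMap.comp_apply, h, map_zero, ← hl₂, hlg, weightTwo_arity₃] at H₂
    exact Submodule.mem_comap.2
      ((Submodule.Quotient.mk_eq_zero S.R₃).1 (congrArg (fun x => x.2.2) H₂).symm)

/-! ### From linear parts to isomorphisms of presentations -/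

/-- If two subspaces embed into each other by restrictions of linear isomorphisms, then these
isomorphisms identify them. -/
theorem le_comap_of_leftInverse {V : Type*} {W : Type*} [AddCommGroup V] [Module k V]
    [FiniteDimensional k V] [AddCommGroup W] [Module k W] [FiniteDimensional k W]
    {p : Submodule k V} {q : Submodule k W} {e : V →ₗ[k] W} {d d' : W →ₗ[k] V} {e' : V →ₗ[k] W}
    (hd : d ∘ₗ e = .id) (hd' : e' ∘ₗ d' = .id) (hp : p ≤ q.comap e) (hq : q ≤ p.comap d') :
    q ≤ p.comap d := by
  have he : Function.Injective e := fun x y h => by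
    simpa [← LinearMap.comp_apply, hd] using congrArg d h
  have he' : Function.Injective d' := fun x y h => by
    simpa [← LinearMap.comp_apply, hd'] using congrArg e' h
  have h₁ : p.map e ≤ q := Submodule.map_le_iff_le_comap.2 hp
  have h₂ : q.map d' ≤ p := Submodule.map_le_iff_le_comap.2 hq
  -- `d'` embeds `q` into `p`, and `e` preserves the dimension of `p`; so the inclusion of `p.map e`
  -- in `q` is an equality.
  have h₃ : Module.finrank k q ≤ Module.finrank k (p.map e) := by
    rw [← (p.equivMapOfInjective e he).finrank_eq, (q.equivMapOfInjective d' he').finrank_eq]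
    exact Submodule.finrank_mono h₂
  intro x hx
  rw [← Submodule.eq_of_le_of_finrank_le h₁ h₃] at hx
  obtain ⟨y, hy, rfl⟩ := hx
  change d (e y) ∈ p
  rwa [← LinearMap.comp_apply, hd]

theorem le_comap_of_eq_comap {V : Type*} {W : Type*} [AddCommGroup V] [Module k V]
    [AddCommGroup W] [Module k W] {p : Submodule k V} {q : Submodule k W} {e : V →ₗ[k] W}
    {d : W →ₗ[k] V} (hd : d ∘ₗ e = .id) (hq : q = p.comap d) : p ≤ q.comap e := by
  rw [hq, ← Submodule.comap_comp, hd, Submodule.comap_id]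

theorem quadMap₂_symm_comp (f : E₁ ≃ₗ[k] F₁) (g : E₂ ≃ₗ[k] F₂) :
    quadMap₂ f.symm.toLinearMap g.symm.toLinearMap ∘ₗ quadMap₂ f.toLinearMap g.toLinearMap
      = .id := by
  ext x y <;> simp [quadMap₂]

theorem quadMap₃_symm_comp (g : E₂ ≃ₗ[k] F₂) :
    quadMap₃ g.symm.toLinearMap ∘ₗ quadMap₃ g.toLinearMap = .id := by
  ext x y <;> simp [quadMap₃]

theorem map_symm_comp (f : E₁ ≃ₗ[k] F₁) :
    TensorProduct.map f.symm.toLinearMap f.symm.toLinearMap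
      ∘ₗ TensorProduct.map f.toLinearMap f.toLinearMap = .id := by
  ext x y; simp

theorem Compat.of_eq_comap {R : QuadRel k E₁ E₂} {S : QuadRel k F₁ F₂} {f : E₁ ≃ₗ[k] F₁}
    {g : E₂ ≃ₗ[k] F₂}
    (h₁ : S.R₁ = R.R₁.comap (TensorProduct.map f.symm.toLinearMap f.symm.toLinearMap))
    (h₂ : S.R₂ = R.R₂.comap (quadMap₂ f.symm.toLinearMap g.symm.toLinearMap))
    (h₃ : S.R₃ = R.R₃.comap (quadMap₃ g.symm.toLinearMap)) :
    Compat R S f.toLinearMap g.toLinearMap where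
  le₁ := le_comap_of_eq_comap (map_symm_comp f) h₁
  le₂ := le_comap_of_eq_comap (quadMap₂_symm_comp f g) h₂
  le₃ := le_comap_of_eq_comap (quadMap₃_symm_comp g) h₃

/-- The maps `f'` and `g'` serve only to compare dimensions of relation spaces; they need not be
inverse to `f` and `g`. -/
theorem Compat.symm [FiniteDimensional k E₁] [FiniteDimensional k E₂]
    [FiniteDimensional k F₁] [FiniteDimensional k F₂]
    {R : QuadRel k E₁ E₂} {S : QuadRel k F₁ F₂} {f : E₁ ≃ₗ[k] F₁} {g : E₂ ≃ₗ[k] F₂}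
    {f' : F₁ ≃ₗ[k] E₁} {g' : F₂ ≃ₗ[k] E₂} (h : Compat R S f.toLinearMap g.toLinearMap)
    (h' : Compat S R f'.toLinearMap g'.toLinearMap) :
    Compat S R f.symm.toLinearMap g.symm.toLinearMap where
  le₁ := le_comap_of_leftInverse (map_symm_comp f) (map_symm_comp f') h.le₁ h'.le₁
  le₂ := le_comap_of_leftInverse (quadMap₂_symm_comp f g) (quadMap₂_symm_comp f' g') h.le₂ h'.le₂
  le₃ := le_comap_of_leftInverse (quadMap₃_symm_comp g) (quadMap₃_symm_comp g') h.le₃ h'.le₃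

/-- Isomorphic operads of quadratic presentations with as many generators have isomorphic
presentations. -/
theorem exists_compat_of_iso [FiniteDimensional k E₁] [FiniteDimensional k E₂]
    [FiniteDimensional k F₁] [FiniteDimensional k F₂]
    (h₁ : Module.finrank k E₁ = Module.finrank k F₁)
    (h₂ : Module.finrank k E₂ = Module.finrank k F₂)
    {R : QuadRel k E₁ E₂} {S : QuadRel k F₁ F₂} (Φ : NSOperad.Iso R.operad S.operad) :
    ∃ (f : E₁ ≃ₗ[k] F₁) (g : E₂ ≃ₗ[k] F₂), Compat R S f.toLinearMap g.toLinearMap ∧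
      Compat S R f.symm.toLinearMap g.symm.toLinearMap := by
  obtain ⟨f, g, h⟩ := exists_linear_part h₁ h₂ Φ.toHom (fun n => (Φ.equiv n).surjective)
  -- The linear part of the inverse need not invert the linear part: when unary generators acquire
  -- scalar parts, quadratic terms contribute to weight one. Hence the detour through `Compat.symm`.
  obtain ⟨f', g', h'⟩ := exists_linear_part h₁.symm h₂.symm Φ.symm.toHom
    (fun n => (Φ.equiv n).symm.surjective)
  exact ⟨f, g, h, h.symm h'⟩

/-- Isomorphic presentations have isomorphic matching operads. -/
theorem nonempty_iso_mat {R : QuadRel k E₁ E₂} {S : QuadRel k F₁ F₂} (f : E₁ ≃ₗ[k] F₁)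
    (g : E₂ ≃ₗ[k] F₂) (h : Compat R S f.toLinearMap g.toLinearMap)
    (h' : Compat S R f.symm.toLinearMap g.symm.toLinearMap) (Ω : Type w) :
    Nonempty (NSOperad.Iso (R.mat Ω).operad (S.mat Ω).operad) :=
  ⟨isoOfCompat (Finsupp.mapRange.linearEquiv f) (Finsupp.mapRange.linearEquiv g)
    (h.mat Ω) (h'.mat Ω)⟩

/-! ## Duality for matching operads -/

section Dual

variable {Ω : Type w}

variable (k Ω) in
/-- The canonical map `⨁ E^* → (⨁ E)^*`. -/
noncomputable def sumDual (E : Type v₁) [AddCommGroup E] [Module k E] :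
    (Ω →₀ Module.Dual k E) →ₗ[k] Module.Dual k (Ω →₀ E) :=
  Finsupp.lsum k fun ω => (Finsupp.lapply ω : (Ω →₀ E) →ₗ[k] E).dualMap

theorem sumDual_single (E : Type v₁) [AddCommGroup E] [Module k E] (ω : Ω) (φ : Module.Dual k E) :
    sumDual k Ω E (Finsupp.single ω φ) = φ ∘ₗ Finsupp.lapply ω := by
  simp [sumDual]
  rfl

/-- Copies with different indices are orthogonal, so a vector supported at `ω` sees only the `ω`
component of the functional. -/
theorem sumDual_apply_single (E : Type v₁) [AddCommGroup E] [Module k E]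
    (x : Ω →₀ Module.Dual k E) (ω : Ω) (e : E) :
    sumDual k Ω E x (Finsupp.single ω e) = x ω e := by
  induction x using Finsupp.induction_linear with
  | zero => simp
  | add x y hx hy => simp [hx, hy]
  | single ω' φ =>
    classical
    rw [sumDual_single]
    by_cases h : ω = ω'
    · subst h; simp
    · simp [Finsupp.single_eq_of_ne h, Finsupp.single_eq_of_ne (Ne.symm h)]

variable [Finite Ω]

variable (k Ω) in
/-- The canonical identification of the dual of a finite direct sum of copies. -/
noncomputable def dualSum (E : Type v₁) [AddCommGroup E] [Module k E] :
    Module.Dual k (Ω →₀ E) ≃ₗ[k] (Ω →₀ Module.Dual k E) :=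
  LinearEquiv.symm
    { sumDual k Ω E with
      invFun := fun φ => (Finsupp.linearEquivFunOnFinite k (Module.Dual k E) Ω).symm
        fun ω => φ ∘ₗ Finsupp.lsingle ω
      left_inv := fun x => by
        ext ω e
        exact sumDual_apply_single E x ω e
      right_inv := fun φ => by
        refine Finsupp.lhom_ext fun ω e => ?_
        exact sumDual_apply_single E _ ω e }

theorem dualSum_symm_toLinearMap (E : Type v₁) [AddCommGroup E] [Module k E] :
    (dualSum k Ω E).symm.toLinearMap = sumDual k Ω E := rfl

theorem dualSum_comp_lapply (E : Type v₁) [AddCommGroup E] [Module k E] (ω : Ω)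
    (φ : Module.Dual k E) : dualSum k Ω E (φ ∘ₗ Finsupp.lapply ω) = Finsupp.single ω φ := by
  rw [← sumDual_single, ← dualSum_symm_toLinearMap]
  exact (dualSum k Ω E).apply_symm_apply _

end Dual

/-- Membership in a sum of copies of a subspace, by components. -/
theorem mem_iSup_map_iff {I : Type*} [Fintype I] {V W : Type*} [AddCommGroup V] [Module k V]
    [AddCommGroup W] [Module k W] (ι : I → V →ₗ[k] W) (π : I → W →ₗ[k] V)
    (hsum : ∀ w, ∑ i, ι i (π i w) = w) (hself : ∀ i v, π i (ι i v) = v)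
    (hne : ∀ i j, i ≠ j → ∀ v, π j (ι i v) = 0) (p : Submodule k V) (w : W) :
    w ∈ ⨆ i, p.map (ι i) ↔ ∀ i, π i w ∈ p := by
  constructor
  · intro hw j
    suffices h : (⨆ i, p.map (ι i)) ≤ p.comap (π j) from h hw
    refine iSup_le fun i => Submodule.map_le_iff_le_comap.2 fun v hv => ?_
    change π j (ι i v) ∈ p
    by_cases hij : i = j
    · subst hij; rwa [hself]
    · rw [hne i j hij]; exact zero_mem _
  · intro hw
    rw [← hsum w]
    exact sum_mem fun i _ => Submodule.mem_iSup_of_mem i (Submodule.mem_map_of_mem (hw i))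

/-! ### Componentwise relations and the orthogonal splitting of the pairing -/

section Components

variable {Ω : Type w}

/-- The component of a weight two element of arity one with given indices. -/
noncomputable def corep₁ (μ ν : Ω) : (Ω →₀ E₁) ⊗[k] (Ω →₀ E₁) →ₗ[k] E₁ ⊗[k] E₁ :=
  TensorProduct.map (Finsupp.lapply ν) (Finsupp.lapply μ)

/-- The component of a weight two element of arity two with given indices. -/
noncomputable def corep₂ (μ ν : Ω) :
    ((Ω →₀ E₁) ⊗[k] (Ω →₀ E₂)) × ((Ω →₀ E₂) ⊗[k] (Ω →₀ E₁)) × ((Ω →₀ E₂) ⊗[k] (Ω →₀ E₁)) →ₗ[k]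
      (E₁ ⊗[k] E₂) × (E₂ ⊗[k] E₁) × (E₂ ⊗[k] E₁) :=
  (TensorProduct.map (Finsupp.lapply μ) (Finsupp.lapply ν)).prodMap
    ((TensorProduct.map (Finsupp.lapply ν) (Finsupp.lapply μ)).prodMap
      (TensorProduct.map (Finsupp.lapply ν) (Finsupp.lapply μ)))

/-- The component of a weight two element of arity three with given indices. -/
noncomputable def corep₃ (μ ν : Ω) :
    ((Ω →₀ E₂) ⊗[k] (Ω →₀ E₂)) × ((Ω →₀ E₂) ⊗[k] (Ω →₀ E₂)) →ₗ[k]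
      (E₂ ⊗[k] E₂) × (E₂ ⊗[k] E₂) :=
  (TensorProduct.map (Finsupp.lapply ν) (Finsupp.lapply μ)).prodMap
    (TensorProduct.map (Finsupp.lapply μ) (Finsupp.lapply ν))

variable {E : Type v₁} {F : Type v₂} [AddCommGroup E] [Module k E] [AddCommGroup F] [Module k F]

theorem map_lapply_map_lsingle_self (i j : Ω) (x : E ⊗[k] F) :
    TensorProduct.map (Finsupp.lapply i) (Finsupp.lapply j)
      (TensorProduct.map (Finsupp.lsingle (R := k) i) (Finsupp.lsingle (R := k) j) x) = x := by
  induction x using TensorProduct.induction_on with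
  | zero => simp
  | add x y hx hy => simp only [map_add, hx, hy]
  | tmul x y => simp

theorem map_lapply_map_lsingle_of_ne {i j i' j' : Ω} (h : ¬ (i = i' ∧ j = j')) (x : E ⊗[k] F) :
    TensorProduct.map (Finsupp.lapply i') (Finsupp.lapply j')
      (TensorProduct.map (Finsupp.lsingle (R := k) i) (Finsupp.lsingle (R := k) j) x) = 0 := by
  induction x using TensorProduct.induction_on with
  | zero => simp
  | add x y hx hy => simp only [map_add, hx, hy, add_zero]
  | tmul x y =>
    rw [not_and_or] at h
    rcases h with h | h
    · simp [Finsupp.single_eq_of_ne (Ne.symm h)]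
    · simp [Finsupp.single_eq_of_ne (Ne.symm h)]

theorem sum_map_lsingle_map_lapply [Fintype Ω] (x : (Ω →₀ E) ⊗[k] (Ω →₀ F)) :
    ∑ p : Ω × Ω, TensorProduct.map (Finsupp.lsingle (R := k) p.1) (Finsupp.lsingle (R := k) p.2)
      (TensorProduct.map (Finsupp.lapply p.1) (Finsupp.lapply p.2) x) = x := by
  induction x using TensorProduct.induction_on with
  | zero => simp
  | add x y hx hy => simp only [map_add, Finset.sum_add_distrib, hx, hy]
  | tmul x y =>
    simp only [TensorProduct.map_tmul, Fintype.sum_prod_type, ← TensorProduct.tmul_sum,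
      ← TensorProduct.sum_tmul, Finsupp.lapply_apply, Finsupp.lsingle_apply,
      Finsupp.univ_sum_single]

/-- Needed for the shapes in which the root carries the second index ν. -/
theorem sum_map_lsingle_map_lapply_swap [Fintype Ω] (x : (Ω →₀ E) ⊗[k] (Ω →₀ F)) :
    ∑ p : Ω × Ω, TensorProduct.map (Finsupp.lsingle (R := k) p.2) (Finsupp.lsingle (R := k) p.1)
      (TensorProduct.map (Finsupp.lapply p.2) (Finsupp.lapply p.1) x) = x := by
  conv_rhs => rw [← sum_map_lsingle_map_lapply x]
  exact Fintype.sum_equiv (Equiv.prodComm Ω Ω) _ _ fun _ => rfl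

/-- The Ω × Ω replicas are independent and exhaust the weight two part, so belonging to the sum of
the copies of `R₁` is decided component by component. -/
theorem mem_mat₁_iff [Finite Ω] (R : QuadRel k E F) (x : (Ω →₀ E) ⊗[k] (Ω →₀ E)) :
    x ∈ (R.mat Ω).R₁ ↔ ∀ μ ν, corep₁ μ ν x ∈ R.R₁ := by
  have := Fintype.ofFinite Ω
  change x ∈ ⨆ (μ : Ω) (ν : Ω), R.R₁.map (rep₁ μ ν) ↔ _
  rw [← iSup_prod (f := fun p : Ω × Ω => R.R₁.map (rep₁ p.1 p.2)),
    ← Prod.forall (p := fun p => corep₁ p.1 p.2 x ∈ R.R₁)]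
  refine mem_iSup_map_iff (fun p : Ω × Ω => rep₁ p.1 p.2) (fun p => corep₁ p.1 p.2)
    sum_map_lsingle_map_lapply_swap (fun p => map_lapply_map_lsingle_self p.2 p.1)
    (fun p q hpq => map_lapply_map_lsingle_of_ne fun h => hpq (Prod.ext h.2 h.1)) _ _

theorem mem_mat₂_iff [Finite Ω] (R : QuadRel k E F)
    (x : ((Ω →₀ E) ⊗[k] (Ω →₀ F)) × ((Ω →₀ F) ⊗[k] (Ω →₀ E)) × ((Ω →₀ F) ⊗[k] (Ω →₀ E))) :
    x ∈ (R.mat Ω).R₂ ↔ ∀ μ ν, corep₂ μ ν x ∈ R.R₂ := by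
  have := Fintype.ofFinite Ω
  change x ∈ ⨆ (μ : Ω) (ν : Ω), R.R₂.map (rep₂ μ ν) ↔ _
  rw [← iSup_prod (f := fun p : Ω × Ω => R.R₂.map (rep₂ p.1 p.2)),
    ← Prod.forall (p := fun p => corep₂ p.1 p.2 x ∈ R.R₂)]
  refine mem_iSup_map_iff (fun p : Ω × Ω => rep₂ p.1 p.2) (fun p => corep₂ p.1 p.2)
    (fun w => ?_) (fun p v => ?_) (fun p q hpq v => ?_) _ _
  · refine Prod.ext ?_ (Prod.ext ?_ ?_)
    -- The unary vertex, which carries μ, is the root only in the first shape; the other two have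
    -- their indices swapped.
    · rw [Prod.fst_sum]; exact sum_map_lsingle_map_lapply w.1
    · rw [Prod.snd_sum, Prod.fst_sum]; exact sum_map_lsingle_map_lapply_swap w.2.1
    · rw [Prod.snd_sum, Prod.snd_sum]; exact sum_map_lsingle_map_lapply_swap w.2.2
  · exact Prod.ext (map_lapply_map_lsingle_self p.1 p.2 v.1)
      (Prod.ext (map_lapply_map_lsingle_self p.2 p.1 v.2.1)
        (map_lapply_map_lsingle_self p.2 p.1 v.2.2))
  · have h₁ : ¬ (p.1 = q.1 ∧ p.2 = q.2) := fun h => hpq (Prod.ext h.1 h.2)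
    have h₂ : ¬ (p.2 = q.2 ∧ p.1 = q.1) := fun h => hpq (Prod.ext h.2 h.1)
    exact Prod.ext (map_lapply_map_lsingle_of_ne h₁ v.1)
      (Prod.ext (map_lapply_map_lsingle_of_ne h₂ v.2.1)
        (map_lapply_map_lsingle_of_ne h₂ v.2.2))

theorem mem_mat₃_iff [Finite Ω] (R : QuadRel k E F)
    (x : ((Ω →₀ F) ⊗[k] (Ω →₀ F)) × ((Ω →₀ F) ⊗[k] (Ω →₀ F))) :
    x ∈ (R.mat Ω).R₃ ↔ ∀ μ ν, corep₃ μ ν x ∈ R.R₃ := by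
  have := Fintype.ofFinite Ω
  change x ∈ ⨆ (μ : Ω) (ν : Ω), R.R₃.map (rep₃ μ ν) ↔ _
  rw [← iSup_prod (f := fun p : Ω × Ω => R.R₃.map (rep₃ p.1 p.2)),
    ← Prod.forall (p := fun p => corep₃ p.1 p.2 x ∈ R.R₃)]
  refine mem_iSup_map_iff (fun p : Ω × Ω => rep₃ p.1 p.2) (fun p => corep₃ p.1 p.2)
    (fun w => ?_) (fun p v => ?_) (fun p q hpq v => ?_) _ _
  · refine Prod.ext ?_ ?_
    · rw [Prod.fst_sum]; exact sum_map_lsingle_map_lapply_swap w.1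
    · rw [Prod.snd_sum]; exact sum_map_lsingle_map_lapply w.2
  · exact Prod.ext (map_lapply_map_lsingle_self p.2 p.1 v.1)
      (map_lapply_map_lsingle_self p.1 p.2 v.2)
  · exact Prod.ext (map_lapply_map_lsingle_of_ne (fun h => hpq (Prod.ext h.2 h.1)) v.1)
      (map_lapply_map_lsingle_of_ne (fun h => hpq (Prod.ext h.1 h.2)) v.2)

/-- Placing indices on vectors is adjoint to extracting the component with those indices on
functionals. The identities for `pair₁`, `pair₂` and `pair₃` follow, the signs being constant on
each shape. -/
theorem dualDistrib_map_sumDual (i j : Ω)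
    (ξ : (Ω →₀ Module.Dual k E) ⊗[k] (Ω →₀ Module.Dual k F)) (r : E ⊗[k] F) :
    TensorProduct.dualDistrib k (Ω →₀ E) (Ω →₀ F)
        (TensorProduct.map (sumDual k Ω E) (sumDual k Ω F) ξ)
        (TensorProduct.map (Finsupp.lsingle (R := k) i) (Finsupp.lsingle (R := k) j) r)
      = TensorProduct.dualDistrib k E F
        (TensorProduct.map (Finsupp.lapply i) (Finsupp.lapply j) ξ) r := by
  induction ξ using TensorProduct.induction_on with
  | zero => simp
  | add x y hx hy => simp only [map_add, LinearMap.add_apply, hx, hy]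
  | tmul x y =>
    induction r using TensorProduct.induction_on with
    | zero => simp
    | add r s hr hs => simp only [map_add, hr, hs]
    | tmul a b => simp [sumDual_apply_single]

theorem pair₁_sumDual (μ ν : Ω) (ξ : (Ω →₀ Module.Dual k E) ⊗[k] (Ω →₀ Module.Dual k E))
    (r : E ⊗[k] E) :
    pair₁ k (Ω →₀ E) (TensorProduct.map (sumDual k Ω E) (sumDual k Ω E) ξ) (rep₁ μ ν r)
      = pair₁ k E (corep₁ μ ν ξ) r :=
  dualDistrib_map_sumDual ν μ ξ r

theorem pair₂_sumDual (μ ν : Ω)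
    (ξ : ((Ω →₀ Module.Dual k E) ⊗[k] (Ω →₀ Module.Dual k F)) ×
      ((Ω →₀ Module.Dual k F) ⊗[k] (Ω →₀ Module.Dual k E)) ×
        ((Ω →₀ Module.Dual k F) ⊗[k] (Ω →₀ Module.Dual k E)))
    (r : (E ⊗[k] F) × (F ⊗[k] E) × (F ⊗[k] E)) :
    pair₂ k (Ω →₀ E) (Ω →₀ F) (quadMap₂ (E₁ := Ω →₀ Module.Dual k E)
        (E₂ := Ω →₀ Module.Dual k F) (sumDual k Ω E) (sumDual k Ω F) ξ) (rep₂ μ ν r)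
      = pair₂ k E F (corep₂ μ ν ξ) r := by
  simp [pair₂, quadMap₂, rep₂, corep₂, dualDistrib_map_sumDual]

theorem pair₃_sumDual (μ ν : Ω)
    (ξ : ((Ω →₀ Module.Dual k F) ⊗[k] (Ω →₀ Module.Dual k F)) ×
        ((Ω →₀ Module.Dual k F) ⊗[k] (Ω →₀ Module.Dual k F)))
    (r : (F ⊗[k] F) × (F ⊗[k] F)) :
    pair₃ k (Ω →₀ F) (quadMap₃ (E₂ := Ω →₀ Module.Dual k F) (sumDual k Ω F) ξ) (rep₃ μ ν r)
      = pair₃ k F (corep₃ μ ν ξ) r := by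
  simp [pair₃, quadMap₃, rep₃, corep₃, dualDistrib_map_sumDual]

theorem mem_dualAnnihilator_iSup_map_iff {V W : Type*} [AddCommGroup V] [Module k V]
    [AddCommGroup W] [Module k W] (ι : Ω → Ω → V →ₗ[k] W) (p : Submodule k V)
    (φ : Module.Dual k W) :
    φ ∈ (⨆ (μ : Ω) (ν : Ω), p.map (ι μ ν)).dualAnnihilator
      ↔ ∀ μ ν, ∀ r ∈ p, φ (ι μ ν r) = 0 := by
  rw [Submodule.mem_dualAnnihilator]
  constructor
  · intro h μ ν r hr
    exact h _ (le_iSup₂ (f := fun μ ν => p.map (ι μ ν)) μ ν (Submodule.mem_map_of_mem hr))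
  · intro h w hw
    suffices H : (⨆ (μ : Ω) (ν : Ω), p.map (ι μ ν)) ≤ LinearMap.ker φ from H hw
    exact iSup₂_le fun μ ν => Submodule.map_le_iff_le_comap.2 (h μ ν)

variable [Finite Ω] (R : QuadRel k E F)

/-- Both sides express the same condition: for all μ and ν, the component of `ξ` with these indices
annihilates `R.R₁`. On the left this is membership by components, on the right the adjunction
`pair₁_sumDual`. -/
theorem koszulDual_mat_R₁ :
    (R.koszulDual.mat Ω).R₁
      = (R.mat Ω).koszulDual.R₁.comap (TensorProduct.map (dualSum k Ω E).symm.toLinearMap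
          (dualSum k Ω E).symm.toLinearMap) := by
  rw [dualSum_symm_toLinearMap]
  ext ξ
  rw [mem_mat₁_iff]
  refine Iff.trans ?_ (mem_dualAnnihilator_iSup_map_iff rep₁ R.R₁ _).symm
  simp only [pair₁_sumDual]
  exact forall₂_congr fun μ ν => Submodule.mem_dualAnnihilator _

theorem koszulDual_mat_R₂ :
    (R.koszulDual.mat Ω).R₂
      = (R.mat Ω).koszulDual.R₂.comap (quadMap₂ (dualSum k Ω E).symm.toLinearMap
          (dualSum k Ω F).symm.toLinearMap) := by
  rw [dualSum_symm_toLinearMap, dualSum_symm_toLinearMap]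
  ext ξ
  rw [mem_mat₂_iff]
  refine Iff.trans ?_ (mem_dualAnnihilator_iSup_map_iff rep₂ R.R₂ _).symm
  simp only [pair₂_sumDual]
  exact forall₂_congr fun μ ν => Submodule.mem_dualAnnihilator _

theorem koszulDual_mat_R₃ :
    (R.koszulDual.mat Ω).R₃
      = (R.mat Ω).koszulDual.R₃.comap (quadMap₃ (dualSum k Ω F).symm.toLinearMap) := by
  rw [dualSum_symm_toLinearMap]
  ext ξ
  rw [mem_mat₃_iff]
  refine Iff.trans ?_ (mem_dualAnnihilator_iSup_map_iff rep₃ R.R₃ _).symm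
  simp only [pair₃_sumDual]
  exact forall₂_congr fun μ ν => Submodule.mem_dualAnnihilator _

theorem compat_dualSum_symm :
    Compat (R.koszulDual.mat Ω) (R.mat Ω).koszulDual (dualSum k Ω E).symm.toLinearMap
      (dualSum k Ω F).symm.toLinearMap :=
  ⟨(koszulDual_mat_R₁ R).le, (koszulDual_mat_R₂ R).le, (koszulDual_mat_R₃ R).le⟩

theorem compat_dualSum :
    Compat (R.mat Ω).koszulDual (R.koszulDual.mat Ω) (dualSum k Ω E).toLinearMap
      (dualSum k Ω F).toLinearMap :=
  Compat.of_eq_comap (koszulDual_mat_R₁ R) (koszulDual_mat_R₂ R) (koszulDual_mat_R₃ R)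

/-- The Koszul dual of a matching operad is the matching operad of the Koszul dual. -/
noncomputable def koszulDualMatIso :
    NSOperad.Iso (R.mat Ω).koszulDual.operad (R.koszulDual.mat Ω).operad :=
  isoOfCompat (dualSum k Ω E) (dualSum k Ω F) R.compat_dualSum R.compat_dualSum_symm

end Components

end QuadRel

/-! ### The theorem -/

theorem mainTheorem3 {k : Type u} [Field k] [CharZero k]
    {E₁ : Type v₁} {E₂ : Type v₂}
    [AddCommGroup E₁] [Module k E₁] [FiniteDimensional k E₁]
    [AddCommGroup E₂] [Module k E₂] [FiniteDimensional k E₂]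
    (R : QuadRel k E₁ E₂) (Ω : Type w) [Finite Ω] [Nonempty Ω] :
    (∃ Φ : NSOperad.Iso (R.mat Ω).koszulDual.operad (R.koszulDual.mat Ω).operad,
      (∀ (ω : Ω) (φ : Module.Dual k E₁),
        Φ.equiv 1 ((R.mat Ω).koszulDual.genUn (φ ∘ₗ Finsupp.lapply ω))
          = (R.koszulDual.mat Ω).genUn (Finsupp.single ω φ)) ∧
      (∀ (ω : Ω) (φ : Module.Dual k E₂),
        Φ.equiv 2 ((R.mat Ω).koszulDual.genBin (φ ∘ₗ Finsupp.lapply ω))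
          = (R.koszulDual.mat Ω).genBin (Finsupp.single ω φ))) ∧
    (R.IsSelfDual → (R.mat Ω).IsSelfDual) := by
  refine ⟨⟨R.koszulDualMatIso, fun ω φ => ?_, fun ω φ => ?_⟩, ?_⟩
  · rw [← QuadRel.dualSum_comp_lapply]
    exact R.compat_dualSum.toHom_genUn _
  · rw [← QuadRel.dualSum_comp_lapply]
    exact R.compat_dualSum.toHom_genBin _
  · rintro ⟨Φ⟩
    -- A finite-dimensional space and its dual have equal dimension, so the isomorphism with the
    -- Koszul dual yields an isomorphism of presentations. Replicating it and applying the duality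
    -- just proved gives the result.
    obtain ⟨f, g, h, h'⟩ := QuadRel.exists_compat_of_iso (Subspace.dual_finrank_eq (V := E₁)).symm
      (Subspace.dual_finrank_eq (V := E₂)).symm Φ
    obtain ⟨Ψ⟩ := QuadRel.nonempty_iso_mat f g h h' Ω
    exact ⟨Ψ.trans R.koszulDualMatIso.symm⟩
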